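/- Let $D\ge 2$ be an integer, $p>1$ and $\kappa\ge 2$ real. For an open, bounded, convex nonempty set $\Omega\subset\mathbb{R}^D$ let $|\Omega|$ be its Lebesgue measure, $P(\Omega)$ its perimeter (the $(D-1)$-dimensional surface measure of $\partial\Omega$) and $R_\Omega$ its inradius. Let $u_p\in W_0^{1,p}(\Omega)$ be the $p$-torsion function of $\Omega$, that is, the unique weak solution of $-\operatorname{div}(|\nabla u|^{p-2}\nabla u)=1$ in $\Omega$, $u=0$ on $\partial\Omega$, and put $$T_p(\Omega)=\int_\Omega u_p\,dx,\qquad T(p;\Omega)=|\Omega|^{p-1}T_p(\Omega)^{1-p},\qquad Q_p(\Omega)=\left(\frac{T(p;\Omega)\,R_\Omega^{\,p}}{\left(\frac{2p-1}{p-1}\right)^{p-1}}\right)^{1/p}.$$ For a family $\mathcal F$ of such sets put $$\gamma_{\mathcal F}(p)=\frac{\inf_{\Omega\in\mathcal F}Q_p(\Omega)}{\sup_{\Omega\in\mathcal F}Q_p(\Omega)}.$$ Let $\mathcal O_\kappa$ be the family of all boxes $\Omega=\prod_{i=1}^D(0,\ell_i)$ with $\ell_1=2R$ and $\ell_j\ge\kappa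 R$ for $j=2,\dots,D$, where $R$ ranges over all positive reals. Then every such box has inradius $R$ and finite perimeter, and satisfies $$\frac{R\,P(\Omega)}{|\Omega|}\le 1+\frac{2(D-1)}{\kappa}.$$ Moreover $$\gamma_{\mathcal O_\kappa}(p)\ \ge\ \frac{\kappa}{\kappa+2(D-1)}.$$ -/

import Mathlib

open MeasureTheory Filter Topology
open scoped ENNReal ContDiff

noncomputable section

namespace Torsion

/-- `ℝ^D` with its Euclidean norm. -/
abbrev E (D : ℕ) : Type := EuclideanSpace ℝ (Fin D)

variable {D : ℕ}

/-- `φ ∈ C_c^∞(Ω)`. -/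
def IsTestFunction (Ω : Set (E D)) (φ : E D → ℝ) : Prop :=
  ContDiff ℝ ∞ φ ∧ HasCompactSupport φ ∧ tsupport φ ⊆ Ω

/-- `u ∈ W_0^{1,p}(Ω)` with gradient `g`: `u` and `g` are in `L^p(Ω)` and `u` is a limit of functions
of `C_c^∞(Ω)` in the `W^{1,p}`-norm, the gradients converging to `g` in `L^p(Ω)`. (Integrating by
parts and passing to the limit, `g` is then the weak gradient of `u`.) -/
def IsSobolevZero (p : ℝ) (Ω : Set (E D)) (u : E D → ℝ) (g : E D → E D) : Prop :=
  MemLp u (ENNReal.ofReal p) (volume.restrict Ω) ∧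
  MemLp g (ENNReal.ofReal p) (volume.restrict Ω) ∧
  ∃ φ : ℕ → E D → ℝ, (∀ n, IsTestFunction Ω (φ n)) ∧
    Tendsto (fun n => eLpNorm (fun x => φ n x - u x) (ENNReal.ofReal p) (volume.restrict Ω))
      atTop (𝓝 0) ∧
    Tendsto (fun n => eLpNorm (fun x => gradient (φ n) x - g x) (ENNReal.ofReal p)
      (volume.restrict Ω)) atTop (𝓝 0)

/-- `u` is a weak solution in `W_0^{1,p}(Ω)` of `-div(|∇u|^{p-2} ∇u) = 1` in `Ω`, `u = 0` on `∂Ω`.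
(Where `g x = 0` the flux `‖g x‖^{p-2} g x` is `0`, also for `p < 2`.) -/
def IsTorsionFunction (p : ℝ) (Ω : Set (E D)) (u : E D → ℝ) : Prop :=
  ∃ g : E D → E D, IsSobolevZero p Ω u g ∧
    ∀ φ : E D → ℝ, IsTestFunction Ω φ →
      ∫ x in Ω, ‖g x‖ ^ (p - 2) * inner ℝ (g x) (gradient φ x) = ∫ x in Ω, φ x

/-- The `p`-torsion function `u_p` of `Ω` (for an open bounded convex set it exists and is unique
up to equality almost everywhere in `Ω`). -/
def torsionFunction (p : ℝ) (Ω : Set (E D)) : E D → ℝ :=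
  Classical.epsilon (IsTorsionFunction p Ω)

/-- The `p`-torsional rigidity `T_p(Ω) = ∫_Ω u_p dx`. -/
def torsionalRigidity (p : ℝ) (Ω : Set (E D)) : ℝ :=
  ∫ x in Ω, torsionFunction p Ω x

/-- The normalized `p`-torsional rigidity `T(p;Ω) = |Ω|^{p-1} T_p(Ω)^{1-p}`. -/
def normalizedRigidity (p : ℝ) (Ω : Set (E D)) : ℝ :=
  volume.real Ω ^ (p - 1) * torsionalRigidity p Ω ^ (1 - p)

/-- The inradius `R_Ω`: the supremum of the radii of the balls contained in `Ω`. -/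
def inradius (Ω : Set (E D)) : ℝ :=
  sSup {r : ℝ | 0 < r ∧ ∃ x : E D, Metric.ball x r ⊆ Ω}

/-- The perimeter `P(Ω)`: the surface measure of `∂Ω`, that is its `(D-1)`-dimensional Hausdorff
measure, normalized to agree with Lebesgue measure on `ℝ^{D-1}`. -/
def perimeter (Ω : Set (E D)) : ℝ≥0∞ :=
  Measure.euclideanHausdorffMeasure (D - 1) (frontier Ω)

/-- `Q_p(Ω) = (T(p;Ω) R_Ω^p / ((2p-1)/(p-1))^{p-1})^{1/p}`. -/
def Q (p : ℝ) (Ω : Set (E D)) : ℝ :=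
  (normalizedRigidity p Ω * inradius Ω ^ p / ((2 * p - 1) / (p - 1)) ^ (p - 1)) ^ (1 / p)

/-- `γ_F(p) = inf_{Ω ∈ F} Q_p(Ω) / sup_{Ω ∈ F} Q_p(Ω)`. (If `Q_p` were unbounded above on `F`, then
the real-valued supremum, and with it this quotient, would be `0`; so a positive lower bound on the
quotient contains the finiteness of the supremum.) -/
def gammaFamily (F : Set (Set (E D))) (p : ℝ) : ℝ :=
  sInf (Q p '' F) / sSup (Q p '' F)

/-- The open box `∏ (0, ℓ_i)`. -/
def box (l : Fin D → ℝ) : Set (E D) :=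
  {x | ∀ i, 0 < x i ∧ x i < l i}

/-- The first side is `2R`, every other side is at least `κR`. -/
def IsSides (κ R : ℝ) (l : Fin D → ℝ) : Prop :=
  0 < R ∧ (∀ i : Fin D, i.val = 0 → l i = 2 * R) ∧ (∀ i : Fin D, i.val ≠ 0 → κ * R ≤ l i)

/-- The family `O_κ` of orthotopes in `ℝ^D`. -/
def orthotopes (D : ℕ) (κ : ℝ) : Set (Set (E D)) :=
  {Ω | ∃ (R : ℝ) (l : Fin D → ℝ), IsSides κ R l ∧ Ω = box l}

end Torsion

end

/-!
The quantity `Q_p` is bounded on both sides by variational principles, with `q` the exponent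
conjugate to `p`. A field `k` with `-div k = 1` gives `T_p(Ω) ≤ ∫_Ω |k|^q` (Thomson); for a box with
first side `2R` the field `k = (R - x_0) e_0` yields `Q_p ≥ 1`. A competitor `f(dist(x, ∂Ω))`, where
`f` is the torsion profile of the interval `(0, 2R)`, bounds `T_p(Ω)` below (Dirichlet) in terms
of the volumes of the inner parallel sets. For a box with sides `l_i` these are boxes with sides
`l_i - 2t`, and Bernoulli's inequality gives their volume the lower bound `|Ω| (1 - t/R)^M` with
`M = ∑ i, 2R / l_i`. This yields `Q_p ≤ M ≤ 1 + 2(D-1)/κ`, and `M` also bounds `R P(Ω) / |Ω|`. The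
torsion function exists by the direct method: by the uniform convexity of `|·|^p`, the gradients of
a minimizing sequence form a Cauchy sequence.
-/

noncomputable section

namespace Torsion

variable {D : ℕ}

section ConvexityDefect

theorem exists_forall_le_mul_of_isCompact {X : Type*} [TopologicalSpace X] {K : Set X}
    (hK : IsCompact K) {f g : X → ℝ} (hf : Continuous f) (hg : Continuous g)
    (hg0 : ∀ x ∈ K, 0 ≤ g x) (hfg : ∀ x ∈ K, g x = 0 → f x < 0) :
    ∃ C : ℝ, 0 < C ∧ ∀ x ∈ K, f x ≤ C * g x := by
  obtain ⟨δ, hδ, hgδ⟩ := (hK.inter_right (isClosed_Ici.preimage hf)).exists_forall_le'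
    (a := 0) hg.continuousOn fun x ⟨hx, (hfx : 0 ≤ f x)⟩ =>
      (hg0 x hx).lt_of_ne' fun h => (hfg x hx h).not_ge hfx
  obtain ⟨M, hM⟩ := hK.exists_bound_of_continuousOn hf.continuousOn
  refine ⟨(|M| + 1) / δ, by positivity, fun x hx => ?_⟩
  rcases lt_or_ge (f x) 0 with h | h
  · exact h.le.trans (mul_nonneg (by positivity) (hg0 x hx))
  · calc f x ≤ |M| + 1 := by
          linarith [(Real.le_norm_self (f x)).trans (hM x hx), le_abs_self M]
      _ = (|M| + 1) / δ * δ := by field_simp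
      _ ≤ (|M| + 1) / δ * g x := by gcongr; exact hgδ x ⟨hx, h⟩

variable {F : Type*} [NormedAddCommGroup F] [NormedSpace ℝ F] {p : ℝ}

/-- The defect in the midpoint convexity inequality for `‖·‖ ^ p`. Integrated over a domain, it
measures how much two almost minimisers of an energy can differ. -/
def convexityDefect (p : ℝ) (a b : F) : ℝ :=
  (‖a‖ ^ p + ‖b‖ ^ p) / 2 - ‖(2⁻¹ : ℝ) • (a + b)‖ ^ p

theorem continuous_convexityDefect (hp : 0 ≤ p) :
    Continuous fun z : F × F => convexityDefect p z.1 z.2 := by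
  unfold convexityDefect
  fun_prop (disch := exact hp)

theorem convexityDefect_smul {r : ℝ} (hr : 0 ≤ r) (a b : F) :
    convexityDefect p (r • a) (r • b) = r ^ p * convexityDefect p a b := by
  simp only [convexityDefect, ← smul_add, smul_comm _ r, norm_smul, Real.norm_of_nonneg hr,
    Real.mul_rpow hr (norm_nonneg _)]
  simp only [Real.mul_rpow hr (mul_nonneg (norm_nonneg (2⁻¹ : ℝ)) (norm_nonneg (a + b)))]
  ring

variable [StrictConvexSpace ℝ F]

theorem convexityDefect_pos (hp : 1 < p) {a b : F} (h : a ≠ b) : 0 < convexityDefect p a b := by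
  have hp0 : 0 < p := by linarith
  have hm : ‖(2⁻¹ : ℝ) • (a + b)‖ = ‖a + b‖ / 2 := by
    rw [norm_smul, Real.norm_of_nonneg (by norm_num)]; ring
  rw [convexityDefect, hm, sub_pos]
  by_cases hab : ‖a‖ = ‖b‖
  · have hlt : ‖a + b‖ / 2 < ‖b‖ := by
      have hne : ‖a + b‖ ≠ ‖a‖ + ‖b‖ := fun heq =>
        h (((sameRay_iff_norm_add).2 heq).eq_of_norm_eq hab)
      linarith [(norm_add_le a b).lt_of_ne hne]
    rw [hab]
    linarith [Real.rpow_lt_rpow (by positivity) hlt hp0]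
  · have hlt := (strictConvexOn_rpow hp).2 (norm_nonneg a) (norm_nonneg b) hab
      (show (0 : ℝ) < 1 / 2 by norm_num) (show (0 : ℝ) < 1 / 2 by norm_num) (by norm_num)
    simp only [smul_eq_mul] at hlt
    have hle : (‖a + b‖ / 2) ^ p ≤ (1 / 2 * ‖a‖ + 1 / 2 * ‖b‖) ^ p :=
      Real.rpow_le_rpow (by positivity) (by linarith [norm_add_le a b]) hp0.le
    linarith

theorem convexityDefect_nonneg (hp : 1 < p) (a b : F) : 0 ≤ convexityDefect p a b := by
  rcases eq_or_ne a b with rfl | h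
  · rw [convexityDefect, ← two_smul ℝ a, smul_smul]
    norm_num
  · exact (convexityDefect_pos hp h).le

-- Both sides are homogeneous of degree `p`, so compactness of the unit sphere of `F × F` suffices.
theorem exists_norm_sub_rpow_le [ProperSpace F] (hp : 1 < p) {ε : ℝ} (hε : 0 < ε) :
    ∃ C : ℝ, 0 < C ∧ ∀ a b : F,
      ‖a - b‖ ^ p ≤ ε * (‖a‖ ^ p + ‖b‖ ^ p) + C * convexityDefect p a b := by
  have hp0 : 0 < p := by linarith
  have hcont : Continuous fun z : F × F => ‖z.1 - z.2‖ ^ p - ε * (‖z.1‖ ^ p + ‖z.2‖ ^ p) := by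
    fun_prop (disch := exact hp0.le)
  obtain ⟨C, hC, hsphere⟩ := exists_forall_le_mul_of_isCompact (isCompact_sphere (0 : F × F) 1)
    hcont (continuous_convexityDefect hp0.le) (fun z _ => convexityDefect_nonneg hp z.1 z.2) (by
      rintro ⟨a, b⟩ hz h0
      obtain rfl : a = b := by_contra fun hab => (convexityDefect_pos hp hab).ne' h0
      have ha : ‖a‖ = 1 := by simpa [Prod.norm_def] using hz
      simp only [sub_self, norm_zero, Real.zero_rpow hp0.ne', ha, Real.one_rpow]
      linarith)
  refine ⟨C, hC, fun a b => ?_⟩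
  rcases eq_or_ne (a, b) (0 : F × F) with hz | hz
  · obtain ⟨rfl, rfl⟩ := Prod.mk_eq_zero.1 hz
    simp [convexityDefect, Real.zero_rpow hp0.ne']
  obtain ⟨r, hr, z, hzs, hrz⟩ : ∃ r : ℝ, 0 ≤ r ∧ ∃ z ∈ Metric.sphere (0 : F × F) 1,
      (a, b) = r • z :=
    ⟨‖(a, b)‖, norm_nonneg _, ‖(a, b)‖⁻¹ • (a, b), by
      rw [mem_sphere_zero_iff_norm, norm_smul, norm_inv, norm_norm,
        inv_mul_cancel₀ (norm_ne_zero_iff.2 hz)], by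
      rw [smul_smul, mul_inv_cancel₀ (norm_ne_zero_iff.2 hz), one_smul]⟩
  obtain ⟨rfl, rfl⟩ : a = r • z.1 ∧ b = r • z.2 := Prod.mk_inj.1 hrz
  rw [convexityDefect_smul hr, ← smul_sub]
  simp only [norm_smul, Real.norm_of_nonneg hr, Real.mul_rpow hr (norm_nonneg _)]
  linarith [mul_le_mul_of_nonneg_left (hsphere z hzs) (Real.rpow_nonneg hr p)]

end ConvexityDefect

section Lp

variable {α F : Type*} [MeasurableSpace α] {μ : Measure α} [NormedAddCommGroup F] {p q : ℝ}

theorem integrable_norm_rpow_of_memLp (hp : 0 < p) {f : α → F}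
    (hf : MemLp f (ENNReal.ofReal p) μ) : Integrable (fun x => ‖f x‖ ^ p) μ := by
  simpa only [ENNReal.toReal_ofReal hp.le] using
    hf.integrable_norm_rpow (ENNReal.ofReal_pos.2 hp).ne' ENNReal.ofReal_ne_top

theorem integrable_convexityDefect [NormedSpace ℝ F] (hp : 0 < p) {f g : α → F}
    (hf : MemLp f (ENNReal.ofReal p) μ) (hg : MemLp g (ENNReal.ofReal p) μ) :
    Integrable (fun x => convexityDefect p (f x) (g x)) μ :=
  (((integrable_norm_rpow_of_memLp hp hf).add (integrable_norm_rpow_of_memLp hp hg)).div_const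
    2).sub (integrable_norm_rpow_of_memLp hp ((hf.add hg).const_smul (2⁻¹ : ℝ)))

theorem eLpNorm_toReal_rpow (hp : 0 < p) {f : α → F} (hf : MemLp f (ENNReal.ofReal p) μ) :
    (eLpNorm f (ENNReal.ofReal p) μ).toReal ^ p = ∫ x, ‖f x‖ ^ p ∂μ := by
  rw [hf.eLpNorm_eq_integral_rpow_norm (ENNReal.ofReal_pos.2 hp).ne' ENNReal.ofReal_ne_top,
    ENNReal.toReal_ofReal hp.le, ENNReal.toReal_ofReal (by positivity),
    Real.rpow_inv_rpow (by positivity) hp.ne']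

theorem tendsto_integral_norm_rpow (hp : 1 ≤ p) {f : ℕ → α → F} {g : α → F}
    (hf : ∀ n, MemLp (f n) (ENNReal.ofReal p) μ) (hg : MemLp g (ENNReal.ofReal p) μ)
    (h : Tendsto (fun n => eLpNorm (fun x => f n x - g x) (ENNReal.ofReal p) μ) atTop (𝓝 0)) :
    Tendsto (fun n => ∫ x, ‖f n x‖ ^ p ∂μ) atTop (𝓝 (∫ x, ‖g x‖ ^ p ∂μ)) := by
  have : Fact (1 ≤ ENNReal.ofReal p) := ⟨ENNReal.one_le_ofReal.2 hp⟩
  have hp0 : 0 < p := by linarith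
  have hnorm := ((Lp.tendsto_Lp_iff_tendsto_eLpNorm'' f hf g hg).2 h).norm.rpow_const
    (p := p) (Or.inr hp0.le)
  simpa only [Lp.norm_toLp, eLpNorm_toReal_rpow hp0 (hf _), eLpNorm_toReal_rpow hp0 hg] using hnorm

theorem exists_memLp_tendsto_of_cauchy [CompleteSpace F] (hp : 1 ≤ p) {f : ℕ → α → F}
    (hf : ∀ n, MemLp (f n) (ENNReal.ofReal p) μ)
    (h : ∀ ε > 0, ∃ N, ∀ m ≥ N, ∀ n ≥ N, ∫ x, ‖f m x - f n x‖ ^ p ∂μ < ε) :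
    ∃ g : α → F, MemLp g (ENNReal.ofReal p) μ ∧
      Tendsto (fun n => eLpNorm (fun x => f n x - g x) (ENNReal.ofReal p) μ) atTop (𝓝 0) := by
  have : Fact (1 ≤ ENNReal.ofReal p) := ⟨ENNReal.one_le_ofReal.2 hp⟩
  have hp0 : 0 < p := by linarith
  have hcauchy : CauchySeq fun n => (hf n).toLp (f n) := by
    rw [Metric.cauchySeq_iff]
    intro ε hε
    obtain ⟨N, hN⟩ := h (ε ^ p) (by positivity)
    refine ⟨N, fun m hm n hn => ?_⟩
    rw [dist_eq_norm, ← MemLp.toLp_sub, Lp.norm_toLp,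
      ← Real.rpow_lt_rpow_iff ENNReal.toReal_nonneg hε.le hp0,
      eLpNorm_toReal_rpow hp0 ((hf m).sub (hf n))]
    exact hN m hm n hn
  obtain ⟨G, hG⟩ := cauchySeq_tendsto_of_complete hcauchy
  exact ⟨G, Lp.memLp G, (Lp.tendsto_Lp_iff_tendsto_eLpNorm'' f hf G (Lp.memLp G)).1
    (by rwa [Lp.toLp_coeFn])⟩

theorem le_of_le_div_add_div (hpq : p.HolderConjugate q) {A B : ℝ} (h : A ≤ A / q + B / p) :
    A ≤ B := by
  have hA : A = A / q + A / p := by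
    rw [div_eq_mul_inv, div_eq_mul_inv, ← mul_add, hpq.symm.inv_add_inv_eq_one, mul_one]
  exact (div_le_div_iff_of_pos_right hpq.pos).1 (by linarith)

variable [InnerProductSpace ℝ F]

theorem integrable_inner_of_memLp (hpq : p.HolderConjugate q) {k g : α → F}
    (hk : MemLp k (ENNReal.ofReal q) μ) (hg : MemLp g (ENNReal.ofReal p) μ) :
    Integrable (fun x => inner ℝ (k x) (g x)) μ := by
  have : ENNReal.HolderTriple (ENNReal.ofReal q) (ENNReal.ofReal p) 1 := hpq.symm.ennrealOfReal
  exact (memLp_one_iff_integrable.1 (hg.norm.mul hk.norm)).mono' (hk.1.inner hg.1)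
    (ae_of_all _ fun x => norm_inner_le_norm _ _)

theorem integral_inner_le_rpow_mul_rpow (hpq : p.HolderConjugate q) {k g : α → F}
    (hk : MemLp k (ENNReal.ofReal q) μ) (hg : MemLp g (ENNReal.ofReal p) μ) :
    ∫ x, inner ℝ (k x) (g x) ∂μ
      ≤ (∫ x, ‖k x‖ ^ q ∂μ) ^ (1 / q) * (∫ x, ‖g x‖ ^ p ∂μ) ^ (1 / p) := by
  have : ENNReal.HolderTriple (ENNReal.ofReal q) (ENNReal.ofReal p) 1 := hpq.symm.ennrealOfReal
  calc ∫ x, inner ℝ (k x) (g x) ∂μ ≤ ∫ x, ‖k x‖ * ‖g x‖ ∂μ :=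
        integral_mono (integrable_inner_of_memLp hpq hk hg)
          (memLp_one_iff_integrable.1 (hg.norm.mul hk.norm)) fun x => real_inner_le_norm _ _
    _ ≤ _ := by
        simpa only [norm_norm] using integral_mul_norm_le_Lp_mul_Lq hpq.symm hk.norm hg.norm

theorem integral_inner_le_div_add_div (hpq : p.HolderConjugate q) {k g : α → F}
    (hk : MemLp k (ENNReal.ofReal q) μ) (hg : MemLp g (ENNReal.ofReal p) μ) :
    ∫ x, inner ℝ (k x) (g x) ∂μ ≤ (∫ x, ‖k x‖ ^ q ∂μ) / q + (∫ x, ‖g x‖ ^ p ∂μ) / p := by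
  have hk0 : 0 ≤ ∫ x, ‖k x‖ ^ q ∂μ := integral_nonneg fun x => by positivity
  have hg0 : 0 ≤ ∫ x, ‖g x‖ ^ p ∂μ := integral_nonneg fun x => by positivity
  simpa only [one_div, Real.rpow_inv_rpow hk0 hpq.symm.ne_zero, Real.rpow_inv_rpow hg0 hpq.ne_zero]
    using (integral_inner_le_rpow_mul_rpow hpq hk hg).trans (Real.young_inequality_of_nonneg
      (Real.rpow_nonneg hk0 _) (Real.rpow_nonneg hg0 _) hpq.symm)

theorem tendsto_integral_inner (hpq : p.HolderConjugate q) {k : α → F}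
    (hk : MemLp k (ENNReal.ofReal q) μ) {f : ℕ → α → F} {g : α → F}
    (hf : ∀ n, MemLp (f n) (ENNReal.ofReal p) μ) (hg : MemLp g (ENNReal.ofReal p) μ)
    (h : Tendsto (fun n => eLpNorm (fun x => f n x - g x) (ENNReal.ofReal p) μ) atTop (𝓝 0)) :
    Tendsto (fun n => ∫ x, inner ℝ (k x) (f n x) ∂μ) atTop (𝓝 (∫ x, inner ℝ (k x) (g x) ∂μ)) := by
  have : ENNReal.HolderTriple (ENNReal.ofReal q) (ENNReal.ofReal p) 1 := hpq.symm.ennrealOfReal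
  refine tendsto_integral_of_L1' _ (integrable_inner_of_memLp hpq hk hg).1
    (Eventually.of_forall fun n => integrable_inner_of_memLp hpq hk (hf n)) ?_
  have hmul : Tendsto (fun n => eLpNorm k (ENNReal.ofReal q) μ *
      eLpNorm (fun x => f n x - g x) (ENNReal.ofReal p) μ) atTop (𝓝 0) := by
    simpa using ENNReal.Tendsto.const_mul h (Or.inr hk.2.ne)
  refine tendsto_of_tendsto_of_tendsto_of_le_of_le tendsto_const_nhds hmul (fun _ => zero_le)
    fun n => ?_
  have hHolder := eLpNorm_le_eLpNorm_mul_eLpNorm_of_nnnorm hk.1 ((hf n).sub hg).1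
    (fun a b => inner ℝ a b) 1 (p := ENNReal.ofReal q) (q := ENNReal.ofReal p) (r := 1)
    (ae_of_all _ fun x => by
      simpa using nnnorm_inner_le_nnnorm (𝕜 := ℝ) (k x) ((f n - g) x))
  simpa [inner_sub_right, Pi.sub_def] using hHolder

theorem tendsto_integral_of_tendsto_eLpNorm [IsFiniteMeasure μ] (hpq : p.HolderConjugate q)
    {f : ℕ → α → ℝ} {u : α → ℝ} (hf : ∀ n, MemLp (f n) (ENNReal.ofReal p) μ)
    (hu : MemLp u (ENNReal.ofReal p) μ)
    (h : Tendsto (fun n => eLpNorm (fun x => f n x - u x) (ENNReal.ofReal p) μ) atTop (𝓝 0)) :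
    Tendsto (fun n => ∫ x, f n x ∂μ) atTop (𝓝 (∫ x, u x ∂μ)) := by
  simpa using tendsto_integral_inner hpq (k := fun _ => (1 : ℝ)) (memLp_const 1) hf hu h

end Lp

section Flux

variable {F : Type*} [NormedAddCommGroup F] {p q : ℝ}

/-- The `p`-Laplacian flux `‖a‖ ^ (p - 2) a`, so that `flux p ∘ ∇u` is the field whose divergence is
the `p`-Laplacian of `u`. -/
def flux [NormedSpace ℝ F] (p : ℝ) (a : F) : F :=
  ‖a‖ ^ (p - 2) • a

theorem norm_flux [NormedSpace ℝ F] (hp : p ≠ 1) (a : F) : ‖flux p a‖ = ‖a‖ ^ (p - 1) := by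
  have hp1 : p - 2 + 1 ≠ 0 := fun h => hp (by linarith)
  rw [flux, norm_smul, Real.norm_of_nonneg (by positivity),
    ← Real.rpow_add_one' (norm_nonneg a) hp1]
  ring_nf

theorem norm_flux_rpow [NormedSpace ℝ F] (hpq : p.HolderConjugate q) (a : F) :
    ‖flux p a‖ ^ q = ‖a‖ ^ p := by
  rw [norm_flux hpq.lt.ne', ← Real.rpow_mul (norm_nonneg a), hpq.sub_one_mul_conj]

variable {α : Type*} [MeasurableSpace α] {μ : Measure α}

theorem aestronglyMeasurable_flux [NormedSpace ℝ F] {g : α → F} (hg : AEStronglyMeasurable g μ) :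
    AEStronglyMeasurable (fun x => flux p (g x)) μ :=
  (hg.norm.aemeasurable.pow_const (p - 2)).aestronglyMeasurable.smul hg

theorem memLp_flux [NormedSpace ℝ F] (hpq : p.HolderConjugate q) {g : α → F}
    (hg : MemLp g (ENNReal.ofReal p) μ) :
    MemLp (fun x => flux p (g x)) (ENNReal.ofReal q) μ := by
  rw [← integrable_norm_rpow_iff (aestronglyMeasurable_flux hg.1)
    (ENNReal.ofReal_pos.2 hpq.symm.pos).ne' ENNReal.ofReal_ne_top,
    ENNReal.toReal_ofReal hpq.symm.nonneg]
  simpa only [norm_flux_rpow hpq] using integrable_norm_rpow_of_memLp hpq.pos hg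

variable [InnerProductSpace ℝ F]

theorem inner_flux_self (hp : p ≠ 0) (a : F) : inner ℝ (flux p a) a = ‖a‖ ^ p := by
  rw [flux, real_inner_smul_left, real_inner_self_eq_norm_sq, ← Real.rpow_natCast,
    ← Real.rpow_add' (norm_nonneg a) (by simpa using hp)]
  norm_num

theorem hasDerivAt_norm_add_smul_rpow (hp : 1 < p) (a b : F) (t : ℝ) :
    HasDerivAt (fun t : ℝ => ‖a + t • b‖ ^ p) (p * inner ℝ (flux p (a + t • b)) b) t := by
  have hline : HasDerivAt (fun t : ℝ => a + t • b) b t := by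
    simpa using ((hasDerivAt_id t).smul_const b).const_add a
  refine ((hasFDerivAt_norm_rpow (a + t • b) hp).comp_hasDerivAt t hline).congr_deriv ?_
  rw [smul_apply, innerSL_apply_apply, flux, real_inner_smul_left, smul_eq_mul,
    mul_assoc]

theorem norm_inner_flux_add_smul_le (hp : 1 < p) (a b : F) {t : ℝ} (ht : |t| ≤ 1) :
    ‖inner ℝ (flux p (a + t • b)) b‖ ≤ (‖a‖ + ‖b‖) ^ p := by
  have hnorm : ‖a + t • b‖ ≤ ‖a‖ + ‖b‖ := by
    refine (norm_add_le _ _).trans (add_le_add_right ?_ _)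
    rw [norm_smul]
    exact mul_le_of_le_one_left (norm_nonneg _) ht
  calc ‖inner ℝ (flux p (a + t • b)) b‖ ≤ ‖a + t • b‖ ^ (p - 1) * ‖b‖ := by
        rw [← norm_flux hp.ne']
        exact norm_inner_le_norm _ _
    _ ≤ (‖a‖ + ‖b‖) ^ (p - 1) * (‖a‖ + ‖b‖) := by
        gcongr
        exact le_add_of_nonneg_left (norm_nonneg _)
    _ = (‖a‖ + ‖b‖) ^ p := by
        rw [← Real.rpow_add_one' (by positivity) (by linarith), sub_add_cancel]

theorem hasDerivAt_integral_norm_add_smul_rpow (hp : 1 < p) {g k : α → F}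
    (hg : MemLp g (ENNReal.ofReal p) μ) (hk : MemLp k (ENNReal.ofReal p) μ) :
    HasDerivAt (fun t : ℝ => ∫ x, ‖g x + t • k x‖ ^ p ∂μ)
      (p * ∫ x, inner ℝ (flux p (g x)) (k x) ∂μ) 0 := by
  have hp0 : 0 < p := by linarith
  have hint : ∀ t : ℝ, Integrable (fun x => ‖g x + t • k x‖ ^ p) μ := fun t =>
    integrable_norm_rpow_of_memLp hp0 (hg.add (hk.const_smul t))
  have hmeas : AEStronglyMeasurable (fun x => p * inner ℝ (flux p (g x + (0 : ℝ) • k x)) (k x)) μ :=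
    ((aestronglyMeasurable_flux (hg.1.add (hk.1.const_smul 0))).inner hk.1).const_mul p
  have hbound : ∀ x, ∀ t ∈ Metric.ball (0 : ℝ) 1,
      ‖p * inner ℝ (flux p (g x + t • k x)) (k x)‖ ≤ p * (‖g x‖ + ‖k x‖) ^ p := by
    intro x t ht
    rw [norm_mul, Real.norm_of_nonneg hp0.le]
    gcongr
    exact norm_inner_flux_add_smul_le hp _ _ (mem_ball_zero_iff.1 ht).le
  have hbound_int : Integrable (fun x => p * (‖g x‖ + ‖k x‖) ^ p) μ := by
    refine ((integrable_norm_rpow_of_memLp hp0 (hg.norm.add hk.norm)).const_mul p).congr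
      (ae_of_all _ fun x => ?_)
    simp only [Pi.add_apply, Real.norm_of_nonneg (add_nonneg (norm_nonneg (g x)) (norm_nonneg _))]
  have hderiv := (hasDerivAt_integral_of_dominated_loc_of_deriv_le
    (Metric.ball_mem_nhds 0 one_pos) (Eventually.of_forall fun t => (hint t).1) (hint 0) hmeas
    (ae_of_all _ hbound) hbound_int
    (ae_of_all _ fun x t _ => hasDerivAt_norm_add_smul_rpow hp (g x) (k x) t)).2
  simpa only [zero_smul, add_zero, integral_const_mul] using hderiv

end Flux

section TestFunctions

variable {Ω : Set (E D)} {φ ψ : E D → ℝ}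

theorem norm_gradient (φ : E D → ℝ) (x : E D) : ‖gradient φ x‖ = ‖fderiv ℝ φ x‖ := by
  simp [gradient]

theorem norm_fderiv_single_le (φ : E D → ℝ) (x : E D) (i : Fin D) :
    ‖fderiv ℝ φ x (EuclideanSpace.single i 1)‖ ≤ ‖gradient φ x‖ := by
  simpa [norm_gradient] using (fderiv ℝ φ x).le_opNorm (EuclideanSpace.single i 1)

theorem IsTestFunction.contDiff_one (h : IsTestFunction Ω φ) : ContDiff ℝ 1 φ :=
  h.1.of_le (by exact_mod_cast le_top)

theorem IsTestFunction.differentiable (h : IsTestFunction Ω φ) : Differentiable ℝ φ :=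
  h.contDiff_one.differentiable one_ne_zero

theorem IsTestFunction.memLp (h : IsTestFunction Ω φ) (P : ℝ≥0∞) (s : Set (E D)) :
    MemLp φ P (volume.restrict s) :=
  (h.contDiff_one.continuous.memLp_of_hasCompactSupport h.2.1).restrict s

theorem IsTestFunction.continuous_gradient (h : IsTestFunction Ω φ) : Continuous (gradient φ) :=
  (InnerProductSpace.toDual ℝ (E D)).symm.continuous.comp
    (h.contDiff_one.continuous_fderiv one_ne_zero)

theorem IsTestFunction.hasCompactSupport_gradient (h : IsTestFunction Ω φ) :
    HasCompactSupport (gradient φ) :=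
  (h.2.1.fderiv ℝ).comp_left (map_zero (InnerProductSpace.toDual ℝ (E D)).symm)

theorem IsTestFunction.memLp_gradient (h : IsTestFunction Ω φ) (P : ℝ≥0∞) (s : Set (E D)) :
    MemLp (gradient φ) P (volume.restrict s) :=
  (h.continuous_gradient.memLp_of_hasCompactSupport h.hasCompactSupport_gradient).restrict s

theorem IsTestFunction.eq_zero (h : IsTestFunction Ω φ) {x : E D} (hx : x ∉ Ω) : φ x = 0 :=
  image_eq_zero_of_notMem_tsupport fun hx' => hx (h.2.2 hx')

theorem IsTestFunction.gradient_eq_zero (h : IsTestFunction Ω φ) {x : E D} (hx : x ∉ Ω) :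
    gradient φ x = 0 := by
  rw [← norm_eq_zero, norm_gradient, norm_eq_zero]
  exact image_eq_zero_of_notMem_tsupport fun hx' => hx (h.2.2 (tsupport_fderiv_subset ℝ hx'))

theorem isTestFunction_zero : IsTestFunction Ω 0 :=
  ⟨contDiff_const, HasCompactSupport.zero, by simp [tsupport]⟩

theorem IsTestFunction.add (h : IsTestFunction Ω φ) (h' : IsTestFunction Ω ψ) :
    IsTestFunction Ω (φ + ψ) :=
  ⟨h.1.add h'.1, h.2.1.add h'.2.1,
    (tsupport_add φ ψ).trans (Set.union_subset h.2.2 h'.2.2)⟩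

theorem IsTestFunction.smul (h : IsTestFunction Ω φ) (c : ℝ) : IsTestFunction Ω (c • φ) :=
  ⟨contDiff_const.smul h.1, h.2.1.smul_left,
    (closure_mono (Function.support_const_smul_subset c φ)).trans h.2.2⟩

theorem IsTestFunction.gradient_add (h : IsTestFunction Ω φ) (h' : IsTestFunction Ω ψ) (x : E D) :
    gradient (φ + ψ) x = gradient φ x + gradient ψ x := by
  simp only [gradient]
  rw [fderiv_add (h.differentiable x) (h'.differentiable x), map_add]

theorem IsTestFunction.gradient_smul (h : IsTestFunction Ω φ) (c : ℝ) (x : E D) :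
    gradient (c • φ) x = c • gradient φ x := by
  simp only [gradient]
  rw [fderiv_const_smul (h.differentiable x) c, map_smul]

theorem IsTestFunction.sub (h : IsTestFunction Ω φ) (h' : IsTestFunction Ω ψ) :
    IsTestFunction Ω (φ - ψ) := by
  simpa [sub_eq_add_neg] using h.add (h'.smul (-1))

theorem IsTestFunction.gradient_sub (h : IsTestFunction Ω φ) (h' : IsTestFunction Ω ψ) (x : E D) :
    gradient (φ - ψ) x = gradient φ x - gradient ψ x := by
  simp only [gradient]
  rw [fderiv_sub (h.differentiable x) (h'.differentiable x), map_sub]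

end TestFunctions

section UnitSource

variable {Ω : Set (E D)} {φ u : E D → ℝ} {p q c r : ℝ} {i : Fin D}

theorem integral_eq_integral_mul_fderiv (i : Fin D) (c : ℝ) (hφ : ContDiff ℝ 1 φ)
    (hc : HasCompactSupport φ) :
    ∫ x, φ x = ∫ x, (c - x i) * fderiv ℝ φ x (EuclideanSpace.single i 1) := by
  have hcoord : Continuous fun x : E D => c - x i := by fun_prop
  have hderiv : ∀ x : E D, HasFDerivAt (fun x : E D => c - x i)
      (-(EuclideanSpace.proj i : E D →L[ℝ] ℝ)) x := fun x =>
    (EuclideanSpace.proj i : E D →L[ℝ] ℝ).hasFDerivAt.const_sub c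
  have hderiv_single : ∀ x : E D,
      fderiv ℝ (fun x : E D => c - x i) x (EuclideanSpace.single i 1) = -1 := fun x => by
    rw [(hderiv x).fderiv]; simp
  have hfderiv : Continuous fun x => fderiv ℝ φ x (EuclideanSpace.single i 1) :=
    (hφ.continuous_fderiv one_ne_zero).clm_apply continuous_const
  rw [integral_mul_fderiv_eq_neg_fderiv_mul_of_integrable]
  · simp only [hderiv_single, neg_mul, one_mul, integral_neg, neg_neg]
  · simp only [hderiv_single]
    exact (continuous_const.mul hφ.continuous).integrable_of_hasCompactSupport hc.mul_left
  · exact (hcoord.mul hfderiv).integrable_of_hasCompactSupport (hc.fderiv_apply ℝ _).mul_left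
  · exact (hcoord.mul hφ.continuous).integrable_of_hasCompactSupport hc.mul_left
  · exact fun x _ => (hderiv x).differentiableAt
  · exact fun x _ => hφ.differentiable one_ne_zero x

/-- The field `k` solves `-div k = 1` in `Ω`, in the weak sense. Such fields are the competitors of
the dual (Thomson) variational principle. -/
def HasUnitSource (Ω : Set (E D)) (k : E D → E D) : Prop :=
  ∀ φ : E D → ℝ, IsTestFunction Ω φ →
    ∫ x in Ω, inner ℝ (k x) (gradient φ x) = ∫ x in Ω, φ x

theorem HasUnitSource.integral_eq {k g : E D → E D} (hk : HasUnitSource Ω k)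
    (hpq : p.HolderConjugate q) (hΩ : Bornology.IsBounded Ω)
    (hkq : MemLp k (ENNReal.ofReal q) (volume.restrict Ω)) (hu : IsSobolevZero p Ω u g) :
    ∫ x in Ω, inner ℝ (k x) (g x) = ∫ x in Ω, u x := by
  obtain ⟨hu, hg, φ, hφ, hφu, hφg⟩ := hu
  have : IsFiniteMeasure (volume.restrict Ω) :=
    isFiniteMeasure_restrict.2 hΩ.measure_lt_top.ne
  have hlim := tendsto_integral_of_tendsto_eLpNorm hpq
    (fun n => (hφ n).memLp (ENNReal.ofReal p) Ω) hu hφu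
  have hlim' := tendsto_integral_inner hpq hkq
    (fun n => (hφ n).memLp_gradient (ENNReal.ofReal p) Ω) hg hφg
  exact tendsto_nhds_unique (hlim'.congr fun n => hk _ (hφ n)) hlim

/-- The field `(c - x_i) e_i`, whose divergence is `-1`. -/
def coordField (i : Fin D) (c : ℝ) (x : E D) : E D :=
  (c - x i) • EuclideanSpace.single i 1

theorem norm_coordField (i : Fin D) (c : ℝ) (x : E D) : ‖coordField i c x‖ = |c - x i| := by
  simp [coordField, norm_smul]

theorem continuous_coordField (i : Fin D) (c : ℝ) : Continuous (coordField i c) := by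
  unfold coordField
  fun_prop

theorem memLp_coordField (hΩ : Bornology.IsBounded Ω) (i : Fin D) (c : ℝ) (P : ℝ≥0∞) :
    MemLp (coordField i c) P (volume.restrict Ω) := by
  obtain ⟨r, hr⟩ := hΩ.subset_closedBall 0
  have hK := isCompact_closedBall (0 : E D) r
  obtain ⟨C, hC⟩ := hK.exists_bound_of_continuousOn (continuous_coordField i c).continuousOn
  have : IsFiniteMeasure (volume.restrict (Metric.closedBall (0 : E D) r)) :=
    isFiniteMeasure_restrict.2 hK.measure_lt_top.ne
  exact (MemLp.of_bound (continuous_coordField i c).aestronglyMeasurable C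
    (ae_restrict_of_forall_mem hK.measurableSet hC)).mono_measure (Measure.restrict_mono_set _ hr)

theorem hasUnitSource_coordField (Ω : Set (E D)) (i : Fin D) (c : ℝ) :
    HasUnitSource Ω (coordField i c) := by
  intro φ hφ
  rw [setIntegral_eq_integral_of_forall_compl_eq_zero fun x hx => hφ.eq_zero hx,
    setIntegral_eq_integral_of_forall_compl_eq_zero fun x hx => by
      rw [hφ.gradient_eq_zero hx, inner_zero_right],
    integral_eq_integral_mul_fderiv i c hφ.contDiff_one hφ.2.1]
  simp [coordField]

theorem IsTestFunction.integral_norm_rpow_eq (h : IsTestFunction Ω φ) (hp : 1 < p) (i : Fin D)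
    (c : ℝ) : ∫ x, ‖φ x‖ ^ p = ∫ x, inner ℝ (flux p (φ x))
      (p * (c - x i) * fderiv ℝ φ x (EuclideanSpace.single i 1)) := by
  have hsupp : HasCompactSupport fun x => ‖φ x‖ ^ p :=
    h.2.1.comp_left (g := fun y : ℝ => ‖y‖ ^ p) (by simp [Real.zero_rpow (by linarith : p ≠ 0)])
  rw [integral_eq_integral_mul_fderiv i c (h.contDiff_one.norm_rpow hp) hsupp]
  refine integral_congr_ae (ae_of_all _ fun x => ?_)
  simp only [h.differentiable.fderiv_norm_rpow hp, smul_apply,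
    ContinuousLinearMap.comp_apply, innerSL_apply_apply, flux,
    RCLike.inner_apply, conj_trivial, smul_eq_mul]
  ring

-- Poincaré's inequality, by absorbing the left-hand side of `integral_norm_rpow_eq` with Young.
theorem IsTestFunction.setIntegral_norm_rpow_le (h : IsTestFunction Ω φ)
    (hpq : p.HolderConjugate q) (hr : ∀ x ∈ Ω, |c - x i| ≤ r) :
    ∫ x in Ω, ‖φ x‖ ^ p ≤ (p * r) ^ p * ∫ x in Ω, ‖gradient φ x‖ ^ p := by
  set g : E D → ℝ := fun x => p * (c - x i) * fderiv ℝ φ x (EuclideanSpace.single i 1)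
  have hg : MemLp g (ENNReal.ofReal p) volume := by
    refine Continuous.memLp_of_hasCompactSupport ?_ (h.2.1.fderiv_apply ℝ _).mul_left
    have := h.contDiff_one.continuous_fderiv one_ne_zero
    fun_prop
  have hφ : MemLp φ (ENNReal.ofReal p) volume := by simpa using h.memLp (ENNReal.ofReal p) Set.univ
  have hgrad : MemLp (gradient φ) (ENNReal.ofReal p) volume := by
    simpa using h.memLp_gradient (ENNReal.ofReal p) Set.univ
  have hgle : ∀ x, ‖g x‖ ^ p ≤ (p * r) ^ p * ‖gradient φ x‖ ^ p := by
    intro x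
    by_cases hx : x ∈ Ω
    · have hr0 : 0 ≤ p * r := mul_nonneg hpq.nonneg ((abs_nonneg _).trans (hr x hx))
      have hpc : ‖p * (c - x i)‖ ≤ p * r := by
        rw [norm_mul, Real.norm_of_nonneg hpq.nonneg]
        exact mul_le_mul_of_nonneg_left (hr x hx) hpq.nonneg
      rw [← Real.mul_rpow hr0 (norm_nonneg _)]
      refine Real.rpow_le_rpow (norm_nonneg _) ?_ hpq.nonneg
      rw [norm_mul]
      exact mul_le_mul hpc (norm_fderiv_single_le φ x i) (norm_nonneg _) hr0
    · have hx0 : g x = 0 := by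
        have hle := norm_fderiv_single_le φ x i
        rw [h.gradient_eq_zero hx, norm_zero, norm_le_zero_iff] at hle
        simp only [g, hle, mul_zero]
      simp [hx0, h.gradient_eq_zero hx, Real.zero_rpow hpq.ne_zero]
  rw [setIntegral_eq_integral_of_forall_compl_eq_zero fun x hx => by
      rw [h.eq_zero hx, norm_zero, Real.zero_rpow hpq.ne_zero],
    setIntegral_eq_integral_of_forall_compl_eq_zero fun x hx => by
      rw [h.gradient_eq_zero hx, norm_zero, Real.zero_rpow hpq.ne_zero]]
  have hYoung := integral_inner_le_div_add_div hpq (memLp_flux hpq hφ) hg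
  simp only [norm_flux_rpow hpq, ← h.integral_norm_rpow_eq hpq.lt i c, g] at hYoung
  refine (le_of_le_div_add_div hpq hYoung).trans ?_
  rw [← integral_const_mul]
  exact integral_mono (integrable_norm_rpow_of_memLp hpq.pos hg)
    ((integrable_norm_rpow_of_memLp hpq.pos hgrad).const_mul _) hgle

end UnitSource

section Existence

variable {Ω : Set (E D)} {p q m : ℝ} {φ ψ u : E D → ℝ} {g : E D → E D}

/-- The energy `(1 / p) ∫ ‖∇u‖ ^ p - ∫ u`, whose minimiser is the torsion function; the gradient is
a separate argument `g`, as in `IsSobolevZero`. -/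
def energy (p : ℝ) (Ω : Set (E D)) (u : E D → ℝ) (g : E D → E D) : ℝ :=
  (∫ x in Ω, ‖g x‖ ^ p) / p - ∫ x in Ω, u x

theorem exists_forall_le_energy (hpq : p.HolderConjugate q) (hΩ : Bornology.IsBounded Ω)
    [NeZero D] : ∃ C : ℝ, ∀ φ : E D → ℝ, IsTestFunction Ω φ →
      (∫ x in Ω, ‖gradient φ x‖ ^ p) / (2 * p) - C ≤ energy p Ω φ (gradient φ) := by
  set k : E D → E D := coordField 0 0
  set s : ℝ := 2 ^ p⁻¹
  have hs : 0 < s := by positivity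
  have hsp : s ^ p = 2 := Real.rpow_inv_rpow zero_le_two hpq.ne_zero
  refine ⟨(∫ x in Ω, ‖s • k x‖ ^ q) / q, fun φ hφ => ?_⟩
  have hYoung := integral_inner_le_div_add_div hpq
    ((memLp_coordField hΩ 0 0 (ENNReal.ofReal q)).const_smul s)
    ((hφ.memLp_gradient (ENNReal.ofReal p) Ω).const_smul s⁻¹)
  have hinner : ∀ x, inner ℝ (s • k x) (s⁻¹ • gradient φ x) = inner ℝ (k x) (gradient φ x) :=
    fun x => by
      rw [real_inner_smul_left, real_inner_smul_right, mul_inv_cancel_left₀ hs.ne']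
  have hnorm : ∀ x, ‖s⁻¹ • gradient φ x‖ ^ p = 2⁻¹ * ‖gradient φ x‖ ^ p := fun x => by
    rw [norm_smul, Real.norm_of_nonneg (by positivity),
      Real.mul_rpow (by positivity) (norm_nonneg _), Real.inv_rpow hs.le, hsp]
  simp only [Pi.smul_apply, hinner, hnorm, integral_const_mul, k,
    hasUnitSource_coordField Ω 0 0 φ hφ] at hYoung
  have hhalf : (∫ x in Ω, ‖gradient φ x‖ ^ p) / p
      = (∫ x in Ω, ‖gradient φ x‖ ^ p) / (2 * p) + 2⁻¹ * (∫ x in Ω, ‖gradient φ x‖ ^ p) / p := by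
    have := hpq.ne_zero
    field_simp
    ring
  rw [energy, hhalf]
  linarith

theorem integral_convexityDefect_gradient_eq (hp : 0 < p) (hφ : IsTestFunction Ω φ)
    (hψ : IsTestFunction Ω ψ) :
    ∫ x in Ω, convexityDefect p (gradient φ x) (gradient ψ x)
      = p * ((energy p Ω φ (gradient φ) + energy p Ω ψ (gradient ψ)) / 2
        - energy p Ω ((2⁻¹ : ℝ) • (φ + ψ)) (gradient ((2⁻¹ : ℝ) • (φ + ψ)))) := by
  have hint : ∀ {χ : E D → ℝ}, IsTestFunction Ω χ →
      Integrable (fun x => ‖gradient χ x‖ ^ p) (volume.restrict Ω) := fun hχ =>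
    integrable_norm_rpow_of_memLp hp (hχ.memLp_gradient _ Ω)
  have hmid := hint ((hφ.add hψ).smul 2⁻¹)
  have hgrad : ∀ x, gradient ((2⁻¹ : ℝ) • (φ + ψ)) x = (2⁻¹ : ℝ) • (gradient φ x + gradient ψ x) :=
    fun x => by rw [(hφ.add hψ).gradient_smul, hφ.gradient_add hψ]
  have hlinear : ∫ x in Ω, ((2⁻¹ : ℝ) • (φ + ψ)) x
      = 2⁻¹ * ((∫ x in Ω, φ x) + ∫ x in Ω, ψ x) := by
    rw [← integral_add (memLp_one_iff_integrable.1 (hφ.memLp 1 _))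
      (memLp_one_iff_integrable.1 (hψ.memLp 1 _)), ← integral_const_mul]
    rfl
  simp only [hgrad] at hmid
  have havg : Integrable (fun x => (‖gradient φ x‖ ^ p + ‖gradient ψ x‖ ^ p) / 2)
      (volume.restrict Ω) := ((hint hφ).add (hint hψ)).div_const 2
  simp only [energy, convexityDefect, hgrad, hlinear]
  rw [integral_sub havg hmid, integral_div, integral_add (hint hφ) (hint hψ)]
  field_simp
  ring

theorem integral_norm_gradient_sub_rpow_le (hp : 0 < p) {ε C : ℝ} (hC : 0 ≤ C)
    (hC' : ∀ a b : E D, ‖a - b‖ ^ p ≤ ε * (‖a‖ ^ p + ‖b‖ ^ p) + C * convexityDefect p a b)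
    (hm : ∀ ψ, IsTestFunction Ω ψ → m ≤ energy p Ω ψ (gradient ψ))
    (hφ : IsTestFunction Ω φ) (hψ : IsTestFunction Ω ψ) :
    ∫ x in Ω, ‖gradient φ x - gradient ψ x‖ ^ p
      ≤ ε * ((∫ x in Ω, ‖gradient φ x‖ ^ p) + ∫ x in Ω, ‖gradient ψ x‖ ^ p)
        + C * p * ((energy p Ω φ (gradient φ) + energy p Ω ψ (gradient ψ)) / 2 - m) := by
  have hLp : ∀ {χ : E D → ℝ}, IsTestFunction Ω χ →
      MemLp (gradient χ) (ENNReal.ofReal p) (volume.restrict Ω) := fun hχ =>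
    hχ.memLp_gradient _ Ω
  have hφi := integrable_norm_rpow_of_memLp hp (hLp hφ)
  have hψi := integrable_norm_rpow_of_memLp hp (hLp hψ)
  have hdefect := integrable_convexityDefect hp (hLp hφ) (hLp hψ)
  have hsum : Integrable (fun x => ε * (‖gradient φ x‖ ^ p + ‖gradient ψ x‖ ^ p))
      (volume.restrict Ω) := (hφi.add hψi).const_mul ε
  calc ∫ x in Ω, ‖gradient φ x - gradient ψ x‖ ^ p
      ≤ ∫ x in Ω, (ε * (‖gradient φ x‖ ^ p + ‖gradient ψ x‖ ^ p)
          + C * convexityDefect p (gradient φ x) (gradient ψ x)) :=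
        integral_mono (integrable_norm_rpow_of_memLp hp ((hLp hφ).sub (hLp hψ)))
          (hsum.add (hdefect.const_mul C)) fun x => hC' _ _
    _ = ε * ((∫ x in Ω, ‖gradient φ x‖ ^ p) + ∫ x in Ω, ‖gradient ψ x‖ ^ p)
        + C * p * ((energy p Ω φ (gradient φ) + energy p Ω ψ (gradient ψ)) / 2
          - energy p Ω ((2⁻¹ : ℝ) • (φ + ψ)) (gradient ((2⁻¹ : ℝ) • (φ + ψ)))) := by
        rw [integral_add hsum (hdefect.const_mul C), integral_const_mul, integral_const_mul,
          integral_add hφi hψi, integral_convexityDefect_gradient_eq hp hφ hψ, mul_assoc C p]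
    _ ≤ _ := by
        gcongr
        exact hm _ ((hφ.add hψ).smul 2⁻¹)

theorem exists_forall_integral_norm_gradient_sub_rpow_lt [NeZero D] (hpq : p.HolderConjugate q)
    (hΩ : Bornology.IsBounded Ω) (hm : ∀ ψ, IsTestFunction Ω ψ → m ≤ energy p Ω ψ (gradient ψ))
    {ε : ℝ} (hε : 0 < ε) :
    ∃ δ > 0, ∀ φ ψ : E D → ℝ, IsTestFunction Ω φ → IsTestFunction Ω ψ →
      energy p Ω φ (gradient φ) < m + δ → energy p Ω ψ (gradient ψ) < m + δ →
      ∫ x in Ω, ‖gradient φ x - gradient ψ x‖ ^ p < ε := by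
  have hp := hpq.pos
  obtain ⟨B, hB⟩ := exists_forall_le_energy hpq hΩ
  set K : ℝ := 2 * p * |m + 1 + B| + 1
  have hK : 0 < K := by positivity
  obtain ⟨C, hC, hC'⟩ := exists_norm_sub_rpow_le (F := E D) hpq.lt
    (ε := ε / (4 * K)) (by positivity)
  have hbound : ∀ χ : E D → ℝ, IsTestFunction Ω χ → energy p Ω χ (gradient χ) < m + 1 →
      ∫ x in Ω, ‖gradient χ x‖ ^ p < K := by
    intro χ hχ hlt
    have hle : (∫ x in Ω, ‖gradient χ x‖ ^ p) / (2 * p) ≤ |m + 1 + B| := by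
      linarith [hB χ hχ, le_abs_self (m + 1 + B)]
    rw [div_le_iff₀' (by positivity)] at hle
    linarith
  refine ⟨min 1 (ε / (2 * (C * p))), by positivity, fun φ ψ hφ hψ hφm hψm => ?_⟩
  have hφK := hbound φ hφ (hφm.trans_le (by gcongr; exact min_le_left _ _))
  have hψK := hbound ψ hψ (hψm.trans_le (by gcongr; exact min_le_left _ _))
  have hgap : (energy p Ω φ (gradient φ) + energy p Ω ψ (gradient ψ)) / 2 - m
      < ε / (2 * (C * p)) := by
    linarith [min_le_right 1 (ε / (2 * (C * p)))]
  calc ∫ x in Ω, ‖gradient φ x - gradient ψ x‖ ^ p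
      ≤ ε / (4 * K) * ((∫ x in Ω, ‖gradient φ x‖ ^ p) + ∫ x in Ω, ‖gradient ψ x‖ ^ p)
        + C * p * ((energy p Ω φ (gradient φ) + energy p Ω ψ (gradient ψ)) / 2 - m) :=
        integral_norm_gradient_sub_rpow_le hp hC.le hC' hm hφ hψ
    _ < ε / (4 * K) * (K + K) + C * p * (ε / (2 * (C * p))) := by gcongr
    _ = ε := by
        field_simp
        ring

theorem tendsto_energy (hpq : p.HolderConjugate q) (hΩ : Bornology.IsBounded Ω)
    {φ : ℕ → E D → ℝ} (hφ : ∀ n, IsTestFunction Ω (φ n))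
    (hu : MemLp u (ENNReal.ofReal p) (volume.restrict Ω))
    (hg : MemLp g (ENNReal.ofReal p) (volume.restrict Ω))
    (hφu : Tendsto (fun n => eLpNorm (fun x => φ n x - u x) (ENNReal.ofReal p)
      (volume.restrict Ω)) atTop (𝓝 0))
    (hφg : Tendsto (fun n => eLpNorm (fun x => gradient (φ n) x - g x) (ENNReal.ofReal p)
      (volume.restrict Ω)) atTop (𝓝 0)) :
    Tendsto (fun n => energy p Ω (φ n) (gradient (φ n))) atTop (𝓝 (energy p Ω u g)) := by
  have : IsFiniteMeasure (volume.restrict Ω) :=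
    isFiniteMeasure_restrict.2 hΩ.measure_lt_top.ne
  exact ((tendsto_integral_norm_rpow hpq.lt.le
    (fun n => (hφ n).memLp_gradient (ENNReal.ofReal p) Ω) hg hφg).div_const p).sub
    (tendsto_integral_of_tendsto_eLpNorm hpq
      (fun n => (hφ n).memLp (ENNReal.ofReal p) Ω) hu hφu)

theorem IsSobolevZero.le_energy (hu : IsSobolevZero p Ω u g) (hpq : p.HolderConjugate q)
    (hΩ : Bornology.IsBounded Ω) (hm : ∀ ψ, IsTestFunction Ω ψ → m ≤ energy p Ω ψ (gradient ψ)) :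
    m ≤ energy p Ω u g := by
  obtain ⟨hu, hg, φ, hφ, hφu, hφg⟩ := hu
  exact ge_of_tendsto' (tendsto_energy hpq hΩ hφ hu hg hφu hφg) fun n => hm _ (hφ n)

theorem IsSobolevZero.add_smul (hu : IsSobolevZero p Ω u g) (hψ : IsTestFunction Ω ψ) (t : ℝ) :
    IsSobolevZero p Ω (u + t • ψ) (fun x => g x + t • gradient ψ x) := by
  obtain ⟨hu, hg, φ, hφ, hφu, hφg⟩ := hu
  refine ⟨hu.add ((hψ.smul t).memLp _ Ω), hg.add ((hψ.memLp_gradient _ Ω).const_smul t),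
    fun n => φ n + t • ψ, fun n => (hφ n).add (hψ.smul t), ?_, ?_⟩
  · simpa using hφu
  · simpa [(hφ _).gradient_add (hψ.smul t), hψ.gradient_smul] using hφg

theorem IsSobolevZero.isTorsionFunction (hu : IsSobolevZero p Ω u g) (hpq : p.HolderConjugate q)
    (hΩ : Bornology.IsBounded Ω)
    (hmin : ∀ ψ, IsTestFunction Ω ψ → energy p Ω u g ≤ energy p Ω ψ (gradient ψ)) :
    IsTorsionFunction p Ω u := by
  refine ⟨g, hu, fun ψ hψ => ?_⟩
  have : IsFiniteMeasure (volume.restrict Ω) :=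
    isFiniteMeasure_restrict.2 hΩ.measure_lt_top.ne
  have hui : Integrable u (volume.restrict Ω) :=
    hu.1.integrable (by simpa using hpq.lt.le)
  have hψi : Integrable ψ (volume.restrict Ω) := memLp_one_iff_integrable.1 (hψ.memLp 1 Ω)
  have henergy : ∀ t : ℝ, energy p Ω (u + t • ψ) (fun x => g x + t • gradient ψ x)
      = (∫ x in Ω, ‖g x + t • gradient ψ x‖ ^ p) / p
        - ((∫ x in Ω, u x) + t * ∫ x in Ω, ψ x) := fun t => by
    rw [energy, ← integral_const_mul, ← integral_add hui (hψi.const_mul t)]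
    rfl
  have hderiv : HasDerivAt
      (fun t : ℝ => energy p Ω (u + t • ψ) (fun x => g x + t • gradient ψ x))
      (p * (∫ x in Ω, inner ℝ (flux p (g x)) (gradient ψ x)) / p - 1 * ∫ x in Ω, ψ x) 0 := by
    simp only [henergy]
    exact ((hasDerivAt_integral_norm_add_smul_rpow hpq.lt hu.2.1
      (hψ.memLp_gradient _ Ω)).div_const p).sub
      (((hasDerivAt_id (0 : ℝ)).mul_const _).const_add _)
  have hlocal : IsLocalMin
      (fun t : ℝ => energy p Ω (u + t • ψ) (fun x => g x + t • gradient ψ x)) 0 :=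
    Eventually.of_forall fun t => by
      simpa using (hu.add_smul hψ t).le_energy hpq hΩ hmin
  have hzero := hlocal.hasDerivAt_eq_zero hderiv
  rw [mul_div_cancel_left₀ _ hpq.ne_zero, one_mul, sub_eq_zero] at hzero
  simpa only [flux, real_inner_smul_left] using hzero

theorem exists_forall_setIntegral_norm_rpow_le [NeZero D] (hpq : p.HolderConjugate q)
    (hΩ : Bornology.IsBounded Ω) : ∃ C > 0, ∀ φ : E D → ℝ, IsTestFunction Ω φ →
      ∫ x in Ω, ‖φ x‖ ^ p ≤ C * ∫ x in Ω, ‖gradient φ x‖ ^ p := by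
  obtain ⟨r, hr, hΩr⟩ := hΩ.subset_closedBall_lt 0 0
  refine ⟨(p * r) ^ p, Real.rpow_pos_of_pos (mul_pos hpq.pos hr) p, fun φ hφ =>
    hφ.setIntegral_norm_rpow_le (i := 0) (c := 0) hpq fun x hx => ?_⟩
  rw [zero_sub, abs_neg]
  exact (PiLp.norm_apply_le x 0).trans (mem_closedBall_zero_iff.1 (hΩr hx))

theorem exists_minimizing_sequence [NeZero D] (hpq : p.HolderConjugate q)
    (hΩ : Bornology.IsBounded Ω) :
    ∃ m : ℝ, (∀ ψ, IsTestFunction Ω ψ → m ≤ energy p Ω ψ (gradient ψ)) ∧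
      ∃ φ : ℕ → E D → ℝ, (∀ n, IsTestFunction Ω (φ n)) ∧
        Tendsto (fun n => energy p Ω (φ n) (gradient (φ n))) atTop (𝓝 m) := by
  obtain ⟨C, hC⟩ := exists_forall_le_energy hpq hΩ
  set S : Set ℝ := (fun φ => energy p Ω φ (gradient φ)) '' {φ | IsTestFunction Ω φ}
  have hne : S.Nonempty := ⟨_, 0, isTestFunction_zero, rfl⟩
  have hbdd : BddBelow S := ⟨-C, by
    rintro _ ⟨φ, hφ, rfl⟩
    have hnonneg : 0 ≤ (∫ x in Ω, ‖gradient φ x‖ ^ p) / (2 * p) :=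
      div_nonneg (integral_nonneg fun x => by positivity) (by linarith [hpq.pos])
    exact le_trans (by linarith) (hC φ hφ)⟩
  obtain ⟨v, -, hv, hvS⟩ := exists_seq_tendsto_sInf hne hbdd
  choose φ hφ hφv using hvS
  exact ⟨sInf S, fun ψ hψ => csInf_le hbdd ⟨ψ, hψ, rfl⟩, φ, hφ, by simpa only [hφv] using hv⟩

theorem exists_isTorsionFunction [NeZero D] (hpq : p.HolderConjugate q)
    (hΩ : Bornology.IsBounded Ω) : ∃ u, IsTorsionFunction p Ω u := by
  obtain ⟨m, hm, φ, hφ, hφm⟩ := exists_minimizing_sequence hpq hΩ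
  have hcauchy : ∀ ε > 0, ∃ N, ∀ a ≥ N, ∀ b ≥ N,
      ∫ x in Ω, ‖gradient (φ a) x - gradient (φ b) x‖ ^ p < ε := by
    intro ε hε
    obtain ⟨δ, hδ, hclose⟩ := exists_forall_integral_norm_gradient_sub_rpow_lt hpq hΩ hm hε
    obtain ⟨N, hN⟩ := eventually_atTop.1 (hφm.eventually (gt_mem_nhds (lt_add_of_pos_right m hδ)))
    exact ⟨N, fun a ha b hb => hclose _ _ (hφ a) (hφ b) (hN a ha) (hN b hb)⟩
  have hcauchy' : ∀ ε > 0, ∃ N, ∀ a ≥ N, ∀ b ≥ N, ∫ x in Ω, ‖φ a x - φ b x‖ ^ p < ε := by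
    intro ε hε
    obtain ⟨C, hC, hpoincare⟩ := exists_forall_setIntegral_norm_rpow_le hpq hΩ
    obtain ⟨N, hN⟩ := hcauchy (ε / C) (by positivity)
    refine ⟨N, fun a ha b hb => (hpoincare _ ((hφ a).sub (hφ b))).trans_lt ?_⟩
    simp only [(hφ a).gradient_sub (hφ b)]
    exact (lt_div_iff₀' hC).1 (hN a ha b hb)
  obtain ⟨g, hg, hφg⟩ := exists_memLp_tendsto_of_cauchy hpq.lt.le
    (fun n => (hφ n).memLp_gradient (ENNReal.ofReal p) Ω) hcauchy
  obtain ⟨u, hu, hφu⟩ := exists_memLp_tendsto_of_cauchy hpq.lt.le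
    (fun n => (hφ n).memLp (ENNReal.ofReal p) Ω) hcauchy'
  have hmin := tendsto_nhds_unique (tendsto_energy hpq hΩ hφ hu hg hφu hφg) hφm
  exact ⟨u, IsSobolevZero.isTorsionFunction ⟨hu, hg, φ, hφ, hφu, hφg⟩ hpq hΩ (hmin ▸ hm)⟩

end Existence

section VariationalPrinciples

variable {Ω : Set (E D)} {p q : ℝ} {u : E D → ℝ}

theorem IsTorsionFunction.exists_gradient (hu : IsTorsionFunction p Ω u)
    (hpq : p.HolderConjugate q) (hΩ : Bornology.IsBounded Ω) :
    ∃ g : E D → E D, IsSobolevZero p Ω u g ∧ HasUnitSource Ω (fun x => flux p (g x)) ∧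
      ∫ x in Ω, u x = ∫ x in Ω, ‖g x‖ ^ p := by
  obtain ⟨g, hg, hweak⟩ := hu
  have hflux : HasUnitSource Ω (fun x => flux p (g x)) := by
    simpa only [HasUnitSource, flux, real_inner_smul_left] using hweak
  refine ⟨g, hg, hflux, ?_⟩
  rw [← hflux.integral_eq hpq hΩ (memLp_flux hpq hg.2.1) hg]
  simp only [inner_flux_self hpq.ne_zero]

theorem IsTorsionFunction.integral_nonneg (hu : IsTorsionFunction p Ω u)
    (hpq : p.HolderConjugate q) (hΩ : Bornology.IsBounded Ω) : 0 ≤ ∫ x in Ω, u x := by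
  obtain ⟨g, -, -, hug⟩ := hu.exists_gradient hpq hΩ
  exact hug ▸ MeasureTheory.integral_nonneg fun x => by positivity

theorem IsTorsionFunction.integral_le_of_hasUnitSource (hu : IsTorsionFunction p Ω u)
    (hpq : p.HolderConjugate q) (hΩ : Bornology.IsBounded Ω) {k : E D → E D}
    (hk : HasUnitSource Ω k) (hkq : MemLp k (ENNReal.ofReal q) (volume.restrict Ω)) :
    ∫ x in Ω, u x ≤ ∫ x in Ω, ‖k x‖ ^ q := by
  obtain ⟨g, hg, -, hug⟩ := hu.exists_gradient hpq hΩ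
  have hYoung := integral_inner_le_div_add_div hpq hkq hg.2.1
  rw [hk.integral_eq hpq hΩ hkq hg, ← hug] at hYoung
  exact le_of_le_div_add_div hpq.symm (by linarith)

theorem IsTorsionFunction.integral_le_rpow_mul_rpow (hu : IsTorsionFunction p Ω u)
    (hpq : p.HolderConjugate q) (hΩ : Bornology.IsBounded Ω) {φ : E D → ℝ}
    (hφ : IsTestFunction Ω φ) :
    ∫ x in Ω, φ x
      ≤ (∫ x in Ω, u x) ^ (1 / q) * (∫ x in Ω, ‖gradient φ x‖ ^ p) ^ (1 / p) := by
  obtain ⟨g, hg, hflux, hug⟩ := hu.exists_gradient hpq hΩ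
  simpa only [hflux φ hφ, norm_flux_rpow hpq, ← hug] using
    integral_inner_le_rpow_mul_rpow hpq (memLp_flux hpq hg.2.1)
      (hφ.memLp_gradient (ENNReal.ofReal p) Ω)

end VariationalPrinciples

section SmoothDistance

open scoped NNReal

theorem exists_contDiff_lipschitzWith_dist_le {G : Type*} [NormedAddCommGroup G]
    [NormedSpace ℝ G] [FiniteDimensional ℝ G] {f : G → ℝ} {K : ℝ≥0} (hf : LipschitzWith K f)
    (hf0 : ∀ x, 0 ≤ f x) {ε : ℝ} (hε : 0 < ε) :
    ∃ g : G → ℝ, ContDiff ℝ ∞ g ∧ LipschitzWith K g ∧ (∀ x, 0 ≤ g x) ∧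
      ∀ a, ∀ δ, (∀ x ∈ Metric.ball a ε, dist (f x) (f a) ≤ δ) → dist (g a) (f a) ≤ δ := by
  borelize G
  set μ : Measure G := .addHaar
  let χ : ContDiffBump (0 : G) := ⟨ε / 2, ε, half_pos hε, half_lt_self hε⟩
  have hint : ∀ x, Integrable (fun t => χ.normed μ t * f (x - t)) μ := fun x =>
    Continuous.integrable_of_hasCompactSupport
      (χ.continuous_normed.mul (hf.continuous.comp (continuous_const.sub continuous_id)))
      χ.hasCompactSupport_normed.mul_right
  refine ⟨fun x => ∫ t, χ.normed μ t * f (x - t) ∂μ, ?_, ?_, fun x => ?_, fun a δ => ?_⟩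
  · exact χ.hasCompactSupport_normed.contDiff_convolution_left (ContinuousLinearMap.lsmul ℝ ℝ)
      χ.contDiff_normed hf.continuous.locallyIntegrable
  · refine LipschitzWith.of_dist_le_mul fun x y => ?_
    rw [Real.dist_eq, ← integral_sub (hint x) (hint y), ← Real.norm_eq_abs]
    calc ‖∫ t, χ.normed μ t * f (x - t) - χ.normed μ t * f (y - t) ∂μ‖
        ≤ ∫ t, χ.normed μ t * (K * dist x y) ∂μ := by
          refine norm_integral_le_of_norm_le (χ.integrable_normed.mul_const _)
            (ae_of_all _ fun t => ?_)
          rw [← mul_sub, norm_mul, Real.norm_of_nonneg (χ.nonneg_normed t)]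
          have hlip := hf.dist_le_mul (x - t) (y - t)
          rw [dist_sub_right] at hlip
          exact mul_le_mul_of_nonneg_left hlip (χ.nonneg_normed t)
      _ = K * dist x y := by rw [integral_mul_const, χ.integral_normed, one_mul]
  · exact integral_nonneg fun t => mul_nonneg (χ.nonneg_normed t) (hf0 _)
  · exact χ.dist_normed_convolution_le hf.continuous.aestronglyMeasurable

theorem closure_subset_of_forall_le_infDist {Ω s : Set (E D)} {ε : ℝ} (hε : 0 < ε)
    (h : ∀ x ∈ s, ε ≤ Metric.infDist x Ωᶜ) : closure s ⊆ Ω := by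
  intro x hx
  have hle : ε ≤ Metric.infDist x Ωᶜ := closure_minimal h
    (isClosed_le continuous_const (Metric.continuous_infDist_pt _)) hx
  by_contra hxΩ
  rw [Metric.infDist_zero_of_mem hxΩ] at hle
  exact hle.not_gt hε

-- Mollify `max (d - 3ε) 0` at scale `ε`, where `d` is the distance to the complement.
theorem exists_isTestFunction_infDist_sub_le {Ω : Set (E D)} (hΩ : Bornology.IsBounded Ω)
    {ε : ℝ} (hε : 0 < ε) :
    ∃ ρ : E D → ℝ, IsTestFunction Ω ρ ∧ LipschitzWith 1 ρ ∧ (∀ x, 0 ≤ ρ x) ∧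
      ∀ x, Metric.infDist x Ωᶜ - 4 * ε ≤ ρ x ∧ ρ x ≤ max (Metric.infDist x Ωᶜ - ε) 0 := by
  set d : E D → ℝ := fun x => Metric.infDist x Ωᶜ
  have hd : LipschitzWith 1 d := Metric.lipschitz_infDist_pt Ωᶜ
  set f : E D → ℝ := fun x => max (d x - 3 * ε) 0
  have hf : LipschitzWith 1 f := by
    simpa using (hd.sub (LipschitzWith.const (3 * ε))).max_const 0
  obtain ⟨ρ, hρ, hρlip, hρ0, hρf⟩ :=
    exists_contDiff_lipschitzWith_dist_le hf (fun x => le_max_right _ _) hε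
  have hρ_near : ∀ x, |ρ x - f x| ≤ ε := fun x =>
    hρf x _ fun y hy => (hf.dist_le_mul y x).trans (by simpa using (Metric.mem_ball.1 hy).le)
  have hρ_zero : ∀ x, d x < 2 * ε → ρ x = 0 := by
    intro x hx
    have hfzero : ∀ y ∈ Metric.ball x ε, f y = 0 := fun y hy => max_eq_right (by
      have hlip := (abs_le.1 (hd.dist_le_mul y x)).2
      rw [NNReal.coe_one, one_mul] at hlip
      linarith [Metric.mem_ball.1 hy])
    have hfx := hfzero x (Metric.mem_ball_self hε)
    simpa [hfx] using hρf x 0 fun y hy => by rw [hfzero y hy, hfx, dist_self]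
  have hsupp : tsupport ρ ⊆ Ω :=
    closure_subset_of_forall_le_infDist (mul_pos two_pos hε) fun x hx =>
      not_lt.1 fun hlt => hx (hρ_zero x hlt)
  refine ⟨ρ, ⟨hρ, Metric.isCompact_of_isClosed_isBounded (isClosed_tsupport ρ)
    (hΩ.subset hsupp), hsupp⟩, hρlip, hρ0, fun x => ⟨?_, ?_⟩⟩
  · linarith [(abs_le.1 (hρ_near x)).1, le_max_left (d x - 3 * ε) 0]
  · rcases lt_or_ge (d x) (2 * ε) with hx | hx
    · exact (hρ_zero x hx).trans_le (le_max_right _ _)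
    · refine le_max_of_le_left ?_
      have hfx : f x ≤ d x - 2 * ε := max_le (by linarith) (by linarith)
      linarith [(abs_le.1 (hρ_near x)).2]

end SmoothDistance

section WebFunctions

open scoped NNReal

variable {Ω : Set (E D)} {p q R : ℝ} {ρ u : E D → ℝ}

/-- The one-dimensional torsion profile `(R ^ q - (R - s) ^ q) / q`. Composed with the distance to
the complement, it gives the trial function of the Dirichlet principle. -/
def profile (R q s : ℝ) : ℝ :=
  (R ^ q - (R - s) ^ q) / q

theorem profile_zero (R q : ℝ) : profile R q 0 = 0 := by
  simp [profile]

theorem hasDerivAt_profile (hq : 1 < q) (s : ℝ) :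
    HasDerivAt (profile R q) ((R - s) ^ (q - 1)) s := by
  have hpow := (Real.hasDerivAt_rpow_const (x := R - s) (Or.inr hq.le)).comp s
    ((hasDerivAt_id s).const_sub R)
  refine ((hpow.const_sub (R ^ q)).div_const q).congr_deriv ?_
  field_simp

theorem continuous_profile (hq : 1 < q) : Continuous (profile R q) :=
  continuous_iff_continuousAt.2 fun s => (hasDerivAt_profile hq s).continuousAt

theorem IsTestFunction.profile_comp (hρ : IsTestFunction Ω ρ) (hρR : ∀ x, ρ x < R) (q : ℝ) :
    IsTestFunction Ω (fun x => profile R q (ρ x)) := by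
  refine ⟨?_, hρ.2.1.comp_left (profile_zero R q),
    (closure_mono (Function.support_comp_subset (profile_zero R q) ρ)).trans hρ.2.2⟩
  exact (contDiff_const.sub ((contDiff_const.sub hρ.1).rpow_const_of_ne
    fun x => (sub_pos.2 (hρR x)).ne')).div_const q

theorem norm_gradient_profile_comp_rpow_le (hpq : p.HolderConjugate q) (hρ : Differentiable ℝ ρ)
    (hlip : LipschitzWith 1 ρ) (hρR : ∀ x, ρ x ≤ R) (x : E D) :
    ‖gradient (fun x => profile R q (ρ x)) x‖ ^ p ≤ (R - ρ x) ^ q := by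
  have hbase : 0 ≤ R - ρ x := sub_nonneg.2 (hρR x)
  have hfderiv : ‖fderiv ℝ ρ x‖ ≤ 1 := norm_fderiv_le_of_lipschitz ℝ hlip
  have hgrad : ‖gradient (fun x => profile R q (ρ x)) x‖ ≤ (R - ρ x) ^ (q - 1) := by
    have hcomp : HasFDerivAt (fun x => profile R q (ρ x)) ((R - ρ x) ^ (q - 1) • fderiv ℝ ρ x) x :=
      (hasDerivAt_profile hpq.symm.lt (ρ x)).comp_hasFDerivAt x (hρ x).hasFDerivAt
    rw [norm_gradient, hcomp.fderiv, norm_smul, Real.norm_of_nonneg (Real.rpow_nonneg hbase _)]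
    exact mul_le_of_le_one_right (Real.rpow_nonneg hbase _) hfderiv
  calc ‖gradient (fun x => profile R q (ρ x)) x‖ ^ p ≤ ((R - ρ x) ^ (q - 1)) ^ p :=
        Real.rpow_le_rpow (norm_nonneg _) hgrad hpq.nonneg
    _ = (R - ρ x) ^ q := by rw [← Real.rpow_mul hbase, hpq.symm.sub_one_mul_conj]

theorem IsTorsionFunction.integral_profile_le_of_isTestFunction (hu : IsTorsionFunction p Ω u)
    (hpq : p.HolderConjugate q) (hΩ : Bornology.IsBounded Ω) (hρ : IsTestFunction Ω ρ)
    (hlip : LipschitzWith 1 ρ) (hρR : ∀ x, ρ x < R) :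
    ∫ x in Ω, profile R q (ρ x)
      ≤ (∫ x in Ω, u x) ^ (1 / q) * (∫ x in Ω, (R - ρ x) ^ q) ^ (1 / p) := by
  have hφ := hρ.profile_comp hρR q
  have : IsFiniteMeasure (volume.restrict Ω) :=
    isFiniteMeasure_restrict.2 hΩ.measure_lt_top.ne
  have hint : Integrable (fun x => (R - ρ x) ^ q) (volume.restrict Ω) := by
    obtain ⟨C, hC⟩ := hρ.2.1.exists_bound_of_continuous hρ.contDiff_one.continuous
    refine Integrable.of_bound (C := (|R| + C) ^ q) ?_ (ae_of_all _ fun x => ?_)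
    · exact ((continuous_const.sub hρ.contDiff_one.continuous).rpow_const fun _ =>
        Or.inr hpq.symm.nonneg).aestronglyMeasurable
    · have hbase : 0 ≤ R - ρ x := sub_nonneg.2 (hρR x).le
      rw [Real.norm_of_nonneg (Real.rpow_nonneg hbase _)]
      refine Real.rpow_le_rpow hbase ?_ hpq.symm.nonneg
      linarith [le_abs_self R, (abs_le.1 (hC x)).1]
  refine (hu.integral_le_rpow_mul_rpow hpq hΩ hφ).trans ?_
  refine mul_le_mul_of_nonneg_left (Real.rpow_le_rpow
    (MeasureTheory.integral_nonneg fun x => Real.rpow_nonneg (norm_nonneg _) _) ?_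
    (one_div_nonneg.2 hpq.nonneg)) (Real.rpow_nonneg (hu.integral_nonneg hpq hΩ) _)
  exact integral_mono (integrable_norm_rpow_of_memLp hpq.pos (hφ.memLp_gradient _ Ω)) hint
    (norm_gradient_profile_comp_rpow_le hpq hρ.differentiable hlip fun x => (hρR x).le)

theorem exists_seq_isTestFunction_tendsto_infDist (hΩ : Bornology.IsBounded Ω) (hR : 0 < R)
    (hΩR : ∀ x ∈ Ω, Metric.infDist x Ωᶜ ≤ R) :
    ∃ ρ : ℕ → E D → ℝ, (∀ n, IsTestFunction Ω (ρ n)) ∧ (∀ n, LipschitzWith 1 (ρ n)) ∧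
      (∀ n x, 0 ≤ ρ n x) ∧ (∀ n x, ρ n x < R) ∧
      ∀ x, Tendsto (fun n => ρ n x) atTop (𝓝 (Metric.infDist x Ωᶜ)) := by
  have hε : ∀ n : ℕ, (0 : ℝ) < 1 / ((n : ℝ) + 1) := fun n => by positivity
  choose ρ hρ hlip hρ0 hρd using fun n => exists_isTestFunction_infDist_sub_le hΩ (hε n)
  have hlim : Tendsto (fun n : ℕ => 1 / ((n : ℝ) + 1)) atTop (𝓝 0) :=
    tendsto_one_div_add_atTop_nhds_zero_nat
  refine ⟨ρ, hρ, hlip, hρ0, fun n x => ?_, fun x => ?_⟩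
  · by_cases hx : x ∈ Ω
    · exact (hρd n x).2.trans_lt (max_lt (by linarith [hΩR x hx, hε n]) hR)
    · exact (hρ n).eq_zero hx ▸ hR
  · refine tendsto_of_tendsto_of_tendsto_of_le_of_le
      (by simpa using (hlim.const_mul 4).const_sub (Metric.infDist x Ωᶜ)) tendsto_const_nhds
      (fun n => (hρd n x).1) fun n => (hρd n x).2.trans ?_
    exact max_le (by linarith [hε n]) Metric.infDist_nonneg

theorem IsTorsionFunction.integral_profile_infDist_le (hu : IsTorsionFunction p Ω u)
    (hpq : p.HolderConjugate q) (hΩ : Bornology.IsBounded Ω) (hR : 0 < R)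
    (hΩR : ∀ x ∈ Ω, Metric.infDist x Ωᶜ ≤ R) :
    ∫ x in Ω, profile R q (Metric.infDist x Ωᶜ) ≤ (∫ x in Ω, u x) ^ (1 / q) *
      (∫ x in Ω, (R - Metric.infDist x Ωᶜ) ^ q) ^ (1 / p) := by
  have : IsFiniteMeasure (volume.restrict Ω) :=
    isFiniteMeasure_restrict.2 hΩ.measure_lt_top.ne
  obtain ⟨ρ, hρ, hlip, hρ0, hρR, hρlim⟩ := exists_seq_isTestFunction_tendsto_infDist hΩ hR hΩR
  have hlim : ∀ {h : ℝ → ℝ}, Continuous h → Tendsto (fun n => ∫ x in Ω, h (ρ n x)) atTop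
      (𝓝 (∫ x in Ω, h (Metric.infDist x Ωᶜ))) := by
    intro h hh
    obtain ⟨C, hC⟩ := (isCompact_Icc (a := 0) (b := R)).exists_bound_of_continuousOn hh.continuousOn
    refine tendsto_integral_of_dominated_convergence (fun _ => C)
      (fun n => (hh.comp (hlip n).continuous).aestronglyMeasurable) (integrable_const C)
      (fun n => ae_of_all _ fun x => hC _ ⟨hρ0 n x, (hρR n x).le⟩)
      (ae_of_all _ fun x => (hh.tendsto _).comp (hρlim x))
  have hpow : Continuous fun s : ℝ => (R - s) ^ q :=
    (continuous_const.sub continuous_id).rpow_const fun _ => Or.inr hpq.symm.nonneg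
  refine le_of_tendsto_of_tendsto' (hlim (continuous_profile hpq.symm.lt))
    (((hlim hpow).rpow_const (Or.inr (one_div_nonneg.2 hpq.nonneg))).const_mul _) fun n => ?_
  exact hu.integral_profile_le_of_isTestFunction hpq hΩ (hρ n) (hlip n) (hρR n)

end WebFunctions

section LayerCake

variable {α : Type*} [MeasurableSpace α] {μ : Measure α} {d : α → ℝ} {M q R : ℝ}

theorem intervalIntegral_max_sub_rpow (hq : 1 < q) {s : ℝ} (hs : s ∈ Set.Icc 0 R) :
    ∫ t in (0 : ℝ)..s, max (R - t) 0 ^ (q - 1) = profile R q s := by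
  have hle : ∀ t ∈ Set.uIcc 0 s, max (R - t) 0 = R - t := fun t ht => by
    rw [Set.uIcc_of_le hs.1] at ht
    exact max_eq_left (by linarith [ht.2, hs.2])
  rw [intervalIntegral.integral_congr fun t ht => by rw [hle t ht],
    intervalIntegral.integral_eq_sub_of_hasDerivAt (fun t _ => hasDerivAt_profile hq t),
    profile_zero, sub_zero]
  exact Continuous.intervalIntegrable ((continuous_const.sub continuous_id).rpow_const
    fun _ => Or.inr (by linarith)) _ _

theorem profile_nonneg (hq : 1 < q) {s : ℝ} (hs : s ∈ Set.Icc 0 R) : 0 ≤ profile R q s := by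
  rw [← intervalIntegral_max_sub_rpow hq hs]
  exact intervalIntegral.integral_nonneg hs.1 fun t _ =>
    Real.rpow_nonneg (le_max_right _ _) _

theorem antitone_measureReal_lt [IsFiniteMeasure μ] (d : α → ℝ) :
    Antitone fun t : ℝ => μ.real {x | t < d x} :=
  fun _ _ hst => measureReal_mono fun _ hx => hst.trans_lt hx

theorem integral_profile_comp_eq [IsFiniteMeasure μ] (hq : 1 < q) (hR : 0 ≤ R)
    (hd : AEMeasurable d μ) (hdR : ∀ᵐ x ∂μ, d x ∈ Set.Icc 0 R) :
    ∫ x, profile R q (d x) ∂μ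
      = ∫ t in (0 : ℝ)..R, μ.real {x | t < d x} * (R - t) ^ (q - 1) := by
  have hg : Continuous fun t : ℝ => max (R - t) 0 ^ (q - 1) :=
    ((continuous_const.sub continuous_id).max continuous_const).rpow_const
      fun _ => Or.inr (by linarith)
  have hcake := lintegral_comp_eq_lintegral_meas_lt_mul μ (hdR.mono fun x hx => hx.1) hd
    (fun t _ => hg.intervalIntegrable 0 t) (ae_of_all _ fun t => by positivity)
  have hvanish : ∀ t ∈ Set.Ioi R,
      μ {x | t < d x} * ENNReal.ofReal (max (R - t) 0 ^ (q - 1)) = 0 := fun t ht => by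
    rw [max_eq_right (sub_nonpos.2 (Set.mem_Ioi.1 ht).le), Real.zero_rpow (by linarith),
      ENNReal.ofReal_zero, mul_zero]
  rw [← Set.Ioc_union_Ioi_eq_Ioi hR, lintegral_union measurableSet_Ioi
    (Set.Ioc_disjoint_Ioi le_rfl), setLIntegral_eq_zero measurableSet_Ioi hvanish,
    add_zero] at hcake
  rw [intervalIntegral.integral_of_le hR, integral_eq_lintegral_of_nonneg_ae,
    integral_eq_lintegral_of_nonneg_ae]
  · refine congrArg ENNReal.toReal ((lintegral_congr_ae (hdR.mono fun x hx => congrArg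
      ENNReal.ofReal (intervalIntegral_max_sub_rpow hq hx).symm)).trans (hcake.trans
        (setLIntegral_congr_fun measurableSet_Ioc fun t ht => ?_)))
    simp only [max_eq_left (sub_nonneg.2 ht.2)]
    rw [ENNReal.ofReal_mul measureReal_nonneg, ofReal_measureReal]
  · exact (ae_restrict_iff' measurableSet_Ioc).2 (ae_of_all _ fun t ht =>
      mul_nonneg measureReal_nonneg (Real.rpow_nonneg (sub_nonneg.2 ht.2) _))
  · exact ((antitone_measureReal_lt d).measurable.mul
      ((measurable_const.sub measurable_id).pow_const _)).aestronglyMeasurable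
  · exact hdR.mono fun x hx => profile_nonneg hq hx
  · exact (continuous_profile hq).comp_aestronglyMeasurable hd.aestronglyMeasurable

theorem intervalIntegral_one_sub_div_rpow_mul (hR : 0 < R) (hM : 0 < M) (hq : 1 < q) :
    ∫ t in (0 : ℝ)..R, (1 - t / R) ^ M * (R - t) ^ (q - 1) = R ^ q / (M + q) := by
  have hpow : ∀ t ∈ Set.uIcc 0 R,
      (1 - t / R) ^ M * (R - t) ^ (q - 1) = (R ^ M)⁻¹ * (R - t) ^ (M + q - 1) := fun t ht => by
    rw [Set.uIcc_of_le hR.le] at ht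
    have hRt : 0 ≤ R - t := by linarith [ht.2]
    rw [one_sub_div hR.ne', Real.div_rpow hRt hR.le, add_sub_assoc,
      Real.rpow_add_of_nonneg hRt hM.le (by linarith)]
    ring
  rw [intervalIntegral.integral_congr hpow, intervalIntegral.integral_const_mul,
    intervalIntegral.integral_comp_sub_left (fun t => t ^ (M + q - 1)) R,
    integral_rpow (Or.inl (by linarith)), sub_self, sub_zero, Real.zero_rpow (by linarith),
    sub_add_cancel, sub_zero, Real.rpow_add hR]
  have := (Real.rpow_pos_of_pos hR M).ne'
  field_simp

theorem le_integral_profile_comp [IsFiniteMeasure μ] (hq : 1 < q) (hR : 0 < R) (hM : 0 < M)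
    (hd : AEMeasurable d μ) (hdR : ∀ᵐ x ∂μ, d x ∈ Set.Icc 0 R) {V : ℝ}
    (hV : ∀ t ∈ Set.Icc 0 R, V * (1 - t / R) ^ M ≤ μ.real {x | t < d x}) :
    V * R ^ q / (M + q) ≤ ∫ x, profile R q (d x) ∂μ := by
  have hpow : Continuous fun t : ℝ => (R - t) ^ (q - 1) :=
    (continuous_const.sub continuous_id).rpow_const fun _ => Or.inr (by linarith)
  rw [integral_profile_comp_eq hq hR.le hd hdR, mul_div_assoc,
    ← intervalIntegral_one_sub_div_rpow_mul hR hM hq, ← intervalIntegral.integral_const_mul]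
  refine intervalIntegral.integral_mono_on hR.le (Continuous.intervalIntegrable ?_ 0 R)
    ((antitone_measureReal_lt d).intervalIntegrable.mul_continuousOn hpow.continuousOn)
    fun t ht => ?_
  · exact continuous_const.mul (((continuous_const.sub (continuous_id.div_const R)).rpow_const
      fun _ => Or.inr hM.le).mul hpow)
  · rw [← mul_assoc]
    exact mul_le_mul_of_nonneg_right (hV t ht) (Real.rpow_nonneg (sub_nonneg.2 ht.2) _)

end LayerCake

section Rigidity

variable {Ω : Set (E D)} {p q M R : ℝ} {u : E D → ℝ}

theorem integral_sub_rpow_eq {α : Type*} [MeasurableSpace α] {μ : Measure α} [IsFiniteMeasure μ]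
    {d : α → ℝ} (hq : 0 < q) (hd : AEMeasurable d μ) (hdR : ∀ᵐ x ∂μ, d x ∈ Set.Icc 0 R) :
    ∫ x, (R - d x) ^ q ∂μ = μ.real Set.univ * R ^ q - q * ∫ x, profile R q (d x) ∂μ := by
  have hint : Integrable (fun x => (R - d x) ^ q) μ := by
    refine Integrable.of_bound ((hd.const_sub R).pow_const q).aestronglyMeasurable (R ^ q)
      (hdR.mono fun x hx => ?_)
    have hRd : 0 ≤ R - d x := sub_nonneg.2 hx.2
    rw [Real.norm_of_nonneg (Real.rpow_nonneg hRd _)]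
    exact Real.rpow_le_rpow hRd (sub_le_self _ hx.1) hq.le
  simp only [profile]
  rw [integral_div, mul_div_cancel₀ _ hq.ne', integral_sub (integrable_const _) hint,
    integral_const, smul_eq_mul, sub_sub_cancel]

theorem le_rpow_mul_of_le_rpow_mul_rpow (hpq : p.HolderConjugate q) {a T : ℝ} (ha : 0 ≤ a)
    (hM : 0 ≤ M) (hT : 0 ≤ T) (h : a ≤ T ^ (1 / q) * (M * a) ^ (1 / p)) :
    a ≤ M ^ (q - 1) * T := by
  rcases ha.eq_or_lt with rfl | ha
  · positivity
  have hq := hpq.symm.pos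
  have hexp : 1 / p * q = q - 1 := by
    rw [one_div, inv_mul_eq_div, div_eq_iff hpq.ne_zero, hpq.symm.sub_one_mul_conj]
  have hpow : a * a ^ (q - 1) ≤ M ^ (q - 1) * T * a ^ (q - 1) := calc
    a * a ^ (q - 1) = a ^ q := by rw [Real.rpow_sub_one ha.ne']; field_simp
    _ ≤ (T ^ (1 / q) * (M * a) ^ (1 / p)) ^ q := Real.rpow_le_rpow ha.le h hq.le
    _ = T * (M * a) ^ (q - 1) := by
      rw [Real.mul_rpow (by positivity) (by positivity), ← Real.rpow_mul hT,
        ← Real.rpow_mul (by positivity), one_div_mul_cancel hq.ne', Real.rpow_one, hexp]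
    _ = M ^ (q - 1) * T * a ^ (q - 1) := by rw [Real.mul_rpow hM ha.le]; ring
  exact le_of_mul_le_mul_right hpow (Real.rpow_pos_of_pos ha _)

theorem IsTorsionFunction.volume_mul_rpow_le (hu : IsTorsionFunction p Ω u)
    (hpq : p.HolderConjugate q) (hΩ : Bornology.IsBounded Ω) (hΩ' : MeasurableSet Ω) (hR : 0 < R)
    (hM : 0 < M) (hΩR : ∀ x ∈ Ω, Metric.infDist x Ωᶜ ≤ R)
    (hV : ∀ t ∈ Set.Icc 0 R, volume.real Ω * (1 - t / R) ^ M
      ≤ volume.real {x ∈ Ω | t < Metric.infDist x Ωᶜ}) :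
    volume.real Ω * R ^ q ≤ (M + q) * (M ^ (q - 1) * ∫ x in Ω, u x) := by
  have : IsFiniteMeasure (volume.restrict Ω) :=
    isFiniteMeasure_restrict.2 hΩ.measure_lt_top.ne
  have hq := hpq.symm.pos
  have hd : Continuous fun x => Metric.infDist x Ωᶜ := Metric.continuous_infDist_pt _
  have hdR : ∀ᵐ x ∂volume.restrict Ω, Metric.infDist x Ωᶜ ∈ Set.Icc 0 R :=
    (ae_restrict_iff' hΩ').2 (ae_of_all _ fun x hx => ⟨Metric.infDist_nonneg, hΩR x hx⟩)
  have hlevel : ∀ t ∈ Set.Icc 0 R, volume.real Ω * (1 - t / R) ^ M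
      ≤ (volume.restrict Ω).real {x | t < Metric.infDist x Ωᶜ} := fun t ht => by
    rw [measureReal_restrict_apply (isOpen_lt continuous_const hd).measurableSet, Set.inter_comm]
    exact hV t ht
  set a := volume.real Ω * R ^ q / (M + q) with ha
  have hprofile : a ≤ ∫ x in Ω, profile R q (Metric.infDist x Ωᶜ) :=
    le_integral_profile_comp hpq.symm.lt hR hM hd.aemeasurable hdR hlevel
  have hgradient : ∫ x in Ω, (R - Metric.infDist x Ωᶜ) ^ q ≤ M * a := by
    rw [integral_sub_rpow_eq hq hd.aemeasurable hdR, measureReal_restrict_apply_univ]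
    have hsplit : volume.real Ω * R ^ q = (M + q) * a := by rw [ha]; field_simp
    nlinarith
  have hkey : a ≤ M ^ (q - 1) * ∫ x in Ω, u x := by
    refine le_rpow_mul_of_le_rpow_mul_rpow hpq (by positivity) hM.le (hu.integral_nonneg hpq hΩ) ?_
    refine (hprofile.trans (hu.integral_profile_infDist_le hpq hΩ hR hΩR)).trans ?_
    refine mul_le_mul_of_nonneg_left (Real.rpow_le_rpow ?_ hgradient (one_div_nonneg.2 hpq.nonneg))
      (Real.rpow_nonneg (hu.integral_nonneg hpq hΩ) _)
    exact integral_nonneg_of_ae (hdR.mono fun x hx => Real.rpow_nonneg (sub_nonneg.2 hx.2) _)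
  exact (div_le_iff₀' (by positivity)).1 hkey

theorem isTorsionFunction_torsionFunction [NeZero D] (hpq : p.HolderConjugate q)
    (hΩ : Bornology.IsBounded Ω) : IsTorsionFunction p Ω (torsionFunction p Ω) :=
  Classical.epsilon_spec (exists_isTorsionFunction hpq hΩ)

theorem torsionalRigidity_nonneg [NeZero D] (hpq : p.HolderConjugate q)
    (hΩ : Bornology.IsBounded Ω) : 0 ≤ torsionalRigidity p Ω :=
  (isTorsionFunction_torsionFunction hpq hΩ).integral_nonneg hpq hΩ

theorem inradius_nonneg (Ω : Set (E D)) : 0 ≤ inradius Ω :=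
  Real.sSup_nonneg fun _ hr => hr.1.le

theorem Q_eq_rpow [NeZero D] (hpq : p.HolderConjugate q) (hΩ : Bornology.IsBounded Ω) :
    Q p Ω = (volume.real Ω * inradius Ω ^ q / ((q + 1) * torsionalRigidity p Ω)) ^ (1 / q) := by
  have hT := torsionalRigidity_nonneg hpq hΩ
  have hr := inradius_nonneg Ω
  have hp := hpq.lt
  have hq := hpq.symm.pos
  have hqp : q * (p - 1) = p := by rw [mul_comm, hpq.sub_one_mul_conj]
  have hconst : (2 * p - 1) / (p - 1) = q + 1 := by
    rw [div_eq_iff (sub_pos.2 hp).ne', add_mul, hqp]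
    ring
  have hexp : (p - 1) * (1 / p) = 1 / q := by
    rw [eq_div_iff hq.ne', mul_one_div, div_mul_eq_mul_div, mul_comm, hqp, div_self hpq.ne_zero]
  have hbase : normalizedRigidity p Ω * inradius Ω ^ p / ((2 * p - 1) / (p - 1)) ^ (p - 1)
      = (volume.real Ω * inradius Ω ^ q / ((q + 1) * torsionalRigidity p Ω)) ^ (p - 1) := by
    rw [hconst, normalizedRigidity, Real.div_rpow (by positivity) (by positivity),
      Real.mul_rpow (by positivity) (by positivity), Real.mul_rpow (by positivity) hT,
      ← Real.rpow_mul hr, hqp, ← neg_sub p 1, Real.rpow_neg hT]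
    ring
  rw [Q, hbase, ← Real.rpow_mul (by positivity), hexp]

theorem one_le_Q [NeZero D] (hpq : p.HolderConjugate q) (hΩ : Bornology.IsBounded Ω)
    (hT : 0 < torsionalRigidity p Ω)
    (h : (q + 1) * torsionalRigidity p Ω ≤ volume.real Ω * inradius Ω ^ q) : 1 ≤ Q p Ω := by
  have hq := hpq.symm.pos
  rw [Q_eq_rpow hpq hΩ]
  exact Real.one_le_rpow ((one_le_div (by positivity)).2 h) (by positivity)

theorem Q_le [NeZero D] (hpq : p.HolderConjugate q) (hΩ : Bornology.IsBounded Ω) (hM : 1 ≤ M)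
    (h : volume.real Ω * inradius Ω ^ q ≤ (M + q) * (M ^ (q - 1) * torsionalRigidity p Ω)) :
    Q p Ω ≤ M := by
  have hq := hpq.symm.pos
  have hT := torsionalRigidity_nonneg hpq hΩ
  have hr := inradius_nonneg Ω
  have hM0 : 0 < M := by linarith
  have hMq : M + q ≤ M * (q + 1) := by nlinarith
  rw [Q_eq_rpow hpq hΩ, one_div, Real.rpow_inv_le_iff_of_pos (by positivity) hM0.le hq]
  refine div_le_of_le_mul₀ (by positivity) (by positivity) (h.trans ?_)
  calc (M + q) * (M ^ (q - 1) * torsionalRigidity p Ω)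
      ≤ M * (q + 1) * (M ^ (q - 1) * torsionalRigidity p Ω) :=
        mul_le_mul_of_nonneg_right hMq (by positivity)
    _ = M ^ q * ((q + 1) * torsionalRigidity p Ω) := by
        rw [Real.rpow_sub_one hM0.ne']; field_simp

end Rigidity

section Boxes

variable {l : Fin D → ℝ} {p q R : ℝ} {i : Fin D}

theorem volume_preimage_ofLp_pi (s : Fin D → Set ℝ) :
    volume (WithLp.ofLp ⁻¹' Set.univ.pi s : Set (E D)) = ∏ i, volume (s i) :=
  ((PiLp.volume_preserving_ofLp (Fin D)).measure_preimage_equiv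
    (f := (MeasurableEquiv.toLp 2 (Fin D → ℝ)).symm) _).trans (volume_pi_pi s)

theorem box_eq_preimage_pi (l : Fin D → ℝ) :
    box l = WithLp.ofLp ⁻¹' Set.univ.pi fun i => Set.Ioo 0 (l i) := by
  ext x
  simp [box]

theorem isOpen_box (l : Fin D → ℝ) : IsOpen (box l) := by
  rw [box_eq_preimage_pi]
  exact (isOpen_set_pi Set.finite_univ fun _ _ => isOpen_Ioo).preimage (PiLp.continuous_ofLp 2 _)

theorem isBounded_box (l : Fin D → ℝ) : Bornology.IsBounded (box l) := by
  rw [box_eq_preimage_pi]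
  exact (PiLp.antilipschitzWith_ofLp 2 _).isBounded_preimage
    (Bornology.IsBounded.pi fun _ => Metric.isBounded_Ioo _ _)

theorem volumeReal_box (hl : ∀ i, 0 ≤ l i) : volume.real (box l) = ∏ i, l i := by
  rw [box_eq_preimage_pi, measureReal_def, volume_preimage_ofLp_pi, ENNReal.toReal_prod]
  simp [hl]

theorem volumeReal_box_pos (hl : ∀ i, 0 < l i) : 0 < volume.real (box l) := by
  rw [volumeReal_box fun i => (hl i).le]
  exact Finset.prod_pos fun i _ => hl i

theorem integral_comp_apply_box (hl : ∀ i, 0 < l i) (i : Fin D) {h : ℝ → ℝ} (hh : Continuous h) :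
    ∫ x in box l, h (x i) = volume.real (box l) / l i * ∫ t in (0 : ℝ)..l i, h t := by
  rw [box_eq_preimage_pi, (PiLp.volume_preserving_ofLp (Fin D)).setIntegral_preimage_emb
      (MeasurableEquiv.toLp 2 (Fin D → ℝ)).symm.measurableEmbedding (fun y => h (y i)) _,
    ← box_eq_preimage_pi, volume_pi, Measure.restrict_pi_pi,
    ← integral_map (φ := Function.eval i) (measurable_pi_apply i).aemeasurable
      hh.aestronglyMeasurable, Measure.pi_map_eval, integral_smul_measure,
    intervalIntegral.integral_of_le (hl i).le, integral_Ioc_eq_integral_Ioo, smul_eq_mul,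
    volumeReal_box fun i => (hl i).le, ← Finset.mul_prod_erase _ _ (Finset.mem_univ i),
    mul_div_cancel_left₀ _ (hl i).ne', ENNReal.toReal_prod]
  simp [fun i => (hl i).le]

theorem intervalIntegral_abs_sub_rpow (hR : 0 < R) (hq : 0 < q) :
    ∫ t in (0 : ℝ)..2 * R, |R - t| ^ q = 2 * R * (R ^ q / (q + 1)) := by
  have hcont : Continuous fun t : ℝ => |t| ^ q := continuous_abs.rpow_const fun _ => Or.inr hq.le
  have hhalf : ∫ t in (0 : ℝ)..R, |t| ^ q = R * (R ^ q / (q + 1)) := by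
    rw [intervalIntegral.integral_congr fun t ht => by
        rw [abs_of_nonneg ((Set.uIcc_of_le hR.le ▸ ht : t ∈ Set.Icc 0 R).1)],
      integral_rpow (Or.inl (by linarith)), Real.zero_rpow (by linarith), sub_zero,
      Real.rpow_add_one hR.ne']
    ring
  have hneg : ∫ t in (-R)..0, |t| ^ q = ∫ t in (0 : ℝ)..R, |t| ^ q := by
    simpa using intervalIntegral.integral_comp_neg (a := -R) (b := 0) fun t : ℝ => |t| ^ q
  rw [intervalIntegral.integral_comp_sub_left (fun t => |t| ^ q) R, sub_zero,
    show R - 2 * R = -R by ring,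
    ← intervalIntegral.integral_add_adjacent_intervals (hcont.intervalIntegrable (-R) 0)
      (hcont.intervalIntegrable 0 R), hneg, hhalf]
  ring

theorem IsTorsionFunction.integral_box_le {u : E D → ℝ} (hu : IsTorsionFunction p (box l) u)
    (hpq : p.HolderConjugate q) (hR : 0 < R) (hl : ∀ j, 0 < l j) (hi : l i = 2 * R) :
    (q + 1) * ∫ x in box l, u x ≤ volume.real (box l) * R ^ q := by
  have hq := hpq.symm.pos
  have hcont : Continuous fun t : ℝ => |R - t| ^ q :=
    (continuous_const.sub continuous_id).abs.rpow_const fun _ => Or.inr hq.le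
  have hdual : ∫ x in box l, u x ≤ volume.real (box l) * R ^ q / (q + 1) := calc
    ∫ x in box l, u x ≤ ∫ x in box l, ‖coordField i R x‖ ^ q :=
      hu.integral_le_of_hasUnitSource hpq (isBounded_box l) (hasUnitSource_coordField _ i R)
        (memLp_coordField (isBounded_box l) i R _)
    _ = volume.real (box l) / l i * ∫ t in (0 : ℝ)..l i, |R - t| ^ q := by
      simp only [norm_coordField]
      exact integral_comp_apply_box hl i hcont
    _ = volume.real (box l) * R ^ q / (q + 1) := by
      rw [hi, intervalIntegral_abs_sub_rpow hR hq]
      field_simp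
  exact (le_div_iff₀' (by positivity)).1 hdual

theorem one_sub_rpow_sum_le_prod {ι : Type*} (s : Finset ι) {c : ι → ℝ}
    (hc : ∀ j ∈ s, c j ∈ Set.Icc 0 1) {t : ℝ} (ht : t ≤ 1) :
    (1 - t) ^ (∑ j ∈ s, c j) ≤ ∏ j ∈ s, (1 - c j * t) := by
  rw [Real.rpow_sum_of_nonneg (sub_nonneg.2 ht) fun j hj => (hc j hj).1]
  refine Finset.prod_le_prod (fun j _ => Real.rpow_nonneg (sub_nonneg.2 ht) _) fun j hj => ?_
  simpa only [mul_neg, ← sub_eq_add_neg] using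
    rpow_one_add_le_one_add_mul_self (neg_le_neg ht) (hc j hj).1 (hc j hj).2

theorem lt_infDist_compl_box [NeZero D] {x : E D} {t : ℝ}
    (hx : ∀ j, x j ∈ Set.Ioo t (l j - t)) : t < Metric.infDist x (box l)ᶜ := by
  have hne : (box l)ᶜ.Nonempty := ⟨0, fun h => (h 0).1.ne rfl⟩
  obtain ⟨y, hy, hxy⟩ := (isOpen_box l).isClosed_compl.exists_infDist_eq_dist hne x
  obtain ⟨j, hj⟩ : ∃ j, 0 < y j → l j ≤ y j := by simpa [box] using hy
  rw [hxy, dist_eq_norm]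
  refine lt_of_lt_of_le ?_ (PiLp.norm_apply_le (x - y) j)
  rw [PiLp.sub_apply, Real.norm_eq_abs, lt_abs]
  rcases le_or_gt (y j) 0 with h | h
  · exact Or.inl (by linarith [(hx j).1])
  · exact Or.inr (by linarith [(hx j).2, hj h])

theorem volumeReal_box_mul_rpow_le [NeZero D] (hR : 0 < R) (hl : ∀ j, 2 * R ≤ l j) {t : ℝ}
    (ht : t ∈ Set.Icc 0 R) : volume.real (box l) * (1 - t / R) ^ (∑ j, 2 * R / l j)
      ≤ volume.real {x ∈ box l | t < Metric.infDist x (box l)ᶜ} := by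
  have hl0 : ∀ j, 0 < l j := fun j => lt_of_lt_of_le (by positivity) (hl j)
  have hsub : (WithLp.ofLp ⁻¹' Set.univ.pi fun j => Set.Ioo t (l j - t) : Set (E D))
      ⊆ {x ∈ box l | t < Metric.infDist x (box l)ᶜ} := fun x hx => by
    have hx' : ∀ j, x j ∈ Set.Ioo t (l j - t) := fun j => hx j (Set.mem_univ j)
    exact ⟨fun j => ⟨ht.1.trans_lt (hx' j).1, by linarith [(hx' j).2, ht.1]⟩,
      lt_infDist_compl_box hx'⟩
  have hbox : volume {x ∈ box l | t < Metric.infDist x (box l)ᶜ} ≠ ⊤ :=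
    ((isBounded_box l).subset fun x hx => hx.1).measure_lt_top.ne
  calc volume.real (box l) * (1 - t / R) ^ (∑ j, 2 * R / l j)
      ≤ (∏ j, l j) * ∏ j, (1 - 2 * R / l j * (t / R)) := by
        rw [volumeReal_box fun j => (hl0 j).le]
        exact mul_le_mul_of_nonneg_left (one_sub_rpow_sum_le_prod _ (fun j _ =>
          ⟨div_nonneg (by positivity) (hl0 j).le, (div_le_one (hl0 j)).2 (hl j)⟩)
          ((div_le_one hR).2 ht.2)) (Finset.prod_nonneg fun j _ => (hl0 j).le)
    _ = ∏ j, (l j - t - t) := by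
        rw [← Finset.prod_mul_distrib]
        refine Finset.prod_congr rfl fun j _ => ?_
        have := (hl0 j).ne'
        field_simp
        ring
    _ = volume.real (WithLp.ofLp ⁻¹' Set.univ.pi fun j => Set.Ioo t (l j - t) : Set (E D)) := by
        rw [measureReal_def, volume_preimage_ofLp_pi, ENNReal.toReal_prod]
        refine Finset.prod_congr rfl fun j _ => ?_
        rw [Real.volume_Ioo, ENNReal.toReal_ofReal (by linarith [hl j, ht.2])]
    _ ≤ volume.real {x ∈ box l | t < Metric.infDist x (box l)ᶜ} := measureReal_mono hsub hbox

end Boxes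

section Inradius

variable {Ω : Set (E D)} {l : Fin D → ℝ} {R : ℝ} {i : Fin D}

theorem bddAbove_radii_of_isBounded [NeZero D] (hΩ : Bornology.IsBounded Ω) :
    BddAbove {r : ℝ | 0 < r ∧ ∃ x : E D, Metric.ball x r ⊆ Ω} := by
  refine ⟨Metric.diam Ω, fun r ⟨hr, x, hx⟩ => ?_⟩
  have hdiam := Metric.diam_mono hx hΩ
  rw [Metric.diam_ball_eq x hr.le] at hdiam
  linarith

theorem infDist_compl_le_inradius [NeZero D] (hΩ : Bornology.IsBounded Ω) (x : E D) :
    Metric.infDist x Ωᶜ ≤ inradius Ω := by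
  rcases (Metric.infDist_nonneg (x := x) (s := Ωᶜ)).eq_or_lt with h | h
  · exact h ▸ inradius_nonneg Ω
  · exact le_csSup (bddAbove_radii_of_isBounded hΩ) ⟨h, x, Metric.ball_infDist_compl_subset⟩

theorem ball_half_subset_box (hl : ∀ j, 2 * R ≤ l j) :
    Metric.ball (WithLp.toLp 2 fun j => l j / 2) R ⊆ box l := fun y hy j => by
  have hyj := (PiLp.norm_apply_le (y - WithLp.toLp 2 fun j => l j / 2) j).trans_lt
    (mem_ball_iff_norm.1 hy)
  rw [PiLp.sub_apply, Real.norm_eq_abs, abs_lt] at hyj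
  constructor <;> linarith [hl j, hyj.1, hyj.2]

theorem two_mul_le_of_ball_subset_box {x : E D} {r : ℝ} (hr : 0 < r)
    (hx : Metric.ball x r ⊆ box l) (i : Fin D) : 2 * r ≤ l i := by
  have hshift : ∀ s, |s| < r → 0 < x i + s ∧ x i + s < l i := fun s hs => by
    simpa using hx (show x + EuclideanSpace.single i s ∈ Metric.ball x r by simpa using hs) i
  have hcenter := hshift 0 (by rwa [abs_zero])
  by_contra! hlt
  have hhalf : |l i / 2| < r := by
    rw [abs_of_pos (by linarith)]
    linarith
  linarith [(hshift (l i / 2) hhalf).2, (hshift (-(l i / 2)) (by rwa [abs_neg])).1]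

theorem inradius_box (hR : 0 < R) (hl : ∀ j, 2 * R ≤ l j) (hi : l i = 2 * R) :
    inradius (box l) = R := by
  refine IsGreatest.csSup_eq ⟨⟨hR, _, ball_half_subset_box hl⟩, fun r ⟨hr, x, hx⟩ => ?_⟩
  have := two_mul_le_of_ball_subset_box hr hx i
  linarith

end Inradius

section QuotientOfBoxes

variable {l : Fin D → ℝ} {p q R : ℝ} {i : Fin D}

theorem one_le_sum_div (hR : 0 < R) (hl : ∀ j, 2 * R ≤ l j) (hi : l i = 2 * R) :
    1 ≤ ∑ j, 2 * R / l j := by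
  have hl0 : ∀ j, 0 < l j := fun j => lt_of_lt_of_le (by positivity) (hl j)
  calc (1 : ℝ) = 2 * R / l i := by rw [hi, div_self (by positivity)]
    _ ≤ ∑ j, 2 * R / l j := Finset.single_le_sum (f := fun j => 2 * R / l j)
      (fun j _ => div_nonneg (by positivity) (hl0 j).le) (Finset.mem_univ i)

theorem volume_mul_rpow_le_torsionalRigidity_box [NeZero D] (hpq : p.HolderConjugate q)
    (hR : 0 < R) (hl : ∀ j, 2 * R ≤ l j) (hi : l i = 2 * R) :
    volume.real (box l) * R ^ q ≤ (∑ j, 2 * R / l j + q) *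
      ((∑ j, 2 * R / l j) ^ (q - 1) * torsionalRigidity p (box l)) := by
  have hΩ := isBounded_box l
  refine (isTorsionFunction_torsionFunction hpq hΩ).volume_mul_rpow_le hpq hΩ
    (isOpen_box l).measurableSet hR (one_pos.trans_le (one_le_sum_div hR hl hi)) (fun x _ => ?_)
    fun t ht => volumeReal_box_mul_rpow_le hR hl ht
  exact (infDist_compl_le_inradius hΩ x).trans_eq (inradius_box hR hl hi)

theorem Q_box_mem_Icc [NeZero D] (hpq : p.HolderConjugate q) (hR : 0 < R) (hl : ∀ j, 2 * R ≤ l j)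
    (hi : l i = 2 * R) : Q p (box l) ∈ Set.Icc 1 (∑ j, 2 * R / l j) := by
  have hl0 : ∀ j, 0 < l j := fun j => lt_of_lt_of_le (by positivity) (hl j)
  have hΩ := isBounded_box l
  have hM := one_le_sum_div hR hl hi
  have hlower := volume_mul_rpow_le_torsionalRigidity_box hpq hR hl hi
  have hupper := (isTorsionFunction_torsionFunction hpq hΩ).integral_box_le hpq hR hl0 hi
  have hT : 0 < torsionalRigidity p (box l) := by
    refine (torsionalRigidity_nonneg hpq hΩ).lt_of_ne' fun hT => ?_
    rw [hT, mul_zero, mul_zero] at hlower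
    exact hlower.not_gt (mul_pos (volumeReal_box_pos hl0) (Real.rpow_pos_of_pos hR q))
  exact ⟨one_le_Q hpq hΩ hT (by rwa [inradius_box hR hl hi]),
    Q_le hpq hΩ hM (by rwa [inradius_box hR hl hi])⟩

end QuotientOfBoxes

section Perimeter

variable {n : ℕ}

/-- The isometric parametrization by `ℝ^n` of the hyperplane `x i = c` of `ℝ^(n+1)`. -/
def insertCoord (i : Fin (n + 1)) (c : ℝ) (y : E n) : E (n + 1) :=
  WithLp.toLp 2 (i.insertNth c y.ofLp : Fin (n + 1) → ℝ)

theorem isometry_insertCoord (i : Fin (n + 1)) (c : ℝ) : Isometry (insertCoord i c) := by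
  refine Isometry.of_dist_eq fun x y => ?_
  rw [EuclideanSpace.dist_eq, EuclideanSpace.dist_eq, Fin.sum_univ_succAbove _ i]
  simp [insertCoord]

/-- The points with `x i = c` and `0 ≤ x j ≤ l j` for `j ≠ i`; for `c = 0` and `c = l i` these are
the two facets of the box that are orthogonal to the `i`-th axis. -/
def boxSlice (l : Fin (n + 1) → ℝ) (i : Fin (n + 1)) (c : ℝ) : Set (E (n + 1)) :=
  insertCoord i c '' (WithLp.ofLp ⁻¹' Set.univ.pi fun j => Set.Icc 0 (l (i.succAbove j)))

theorem hausdorffMeasure_boxSlice (l : Fin (n + 1) → ℝ) (i : Fin (n + 1)) (c : ℝ) :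
    Measure.euclideanHausdorffMeasure n (boxSlice l i c)
      = ∏ j, ENNReal.ofReal (l (i.succAbove j)) := by
  rw [boxSlice, (isometry_insertCoord i c).euclideanHausdorffMeasure_image,
    EuclideanSpace.euclideanHausdorffMeasure_eq_volume, volume_preimage_ofLp_pi]
  simp

theorem mem_boxSlice {l : Fin (n + 1) → ℝ} {x : E (n + 1)} (hx : ∀ j, x j ∈ Set.Icc 0 (l j))
    (i : Fin (n + 1)) : x ∈ boxSlice l i (x i) :=
  ⟨WithLp.toLp 2 (i.removeNth x.ofLp), fun j _ => hx (i.succAbove j), by simp [insertCoord]⟩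

theorem frontier_box_subset (l : Fin (n + 1) → ℝ) :
    frontier (box l) ⊆ ⋃ i, (boxSlice l i 0 ∪ boxSlice l i (l i)) := by
  intro x hx
  rw [(isOpen_box l).frontier_eq] at hx
  have hclosed : IsClosed
      (WithLp.ofLp ⁻¹' Set.univ.pi fun i => Set.Icc 0 (l i) : Set (E (n + 1))) :=
    (isClosed_set_pi fun _ _ => isClosed_Icc).preimage (PiLp.continuous_ofLp 2 _)
  have hmem : ∀ i, x i ∈ Set.Icc 0 (l i) := fun i =>
    closure_minimal (fun y hy j _ => ⟨(hy j).1.le, (hy j).2.le⟩) hclosed hx.1 i (Set.mem_univ i)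
  obtain ⟨i, hi⟩ : ∃ i, 0 < x i → l i ≤ x i := by simpa [box] using hx.2
  refine Set.mem_iUnion.2 ⟨i, ?_⟩
  rcases (hmem i).1.eq_or_lt with h | h
  · exact Or.inl (h ▸ mem_boxSlice hmem i)
  · exact Or.inr (((hmem i).2.antisymm (hi h)) ▸ mem_boxSlice hmem i)

theorem perimeter_box_le {l : Fin (n + 1) → ℝ} (hl : ∀ i, 0 < l i) :
    perimeter (box l) ≤ ENNReal.ofReal (∑ i, 2 * (volume.real (box l) / l i)) := by
  have hV := (volumeReal_box_pos hl).le
  refine (measure_mono (frontier_box_subset l)).trans ((measure_iUnion_fintype_le _ _).trans ?_)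
  rw [ENNReal.ofReal_sum_of_nonneg fun i _ => mul_nonneg zero_le_two (div_nonneg hV (hl i).le)]
  refine Finset.sum_le_sum fun i _ => (measure_union_le _ _).trans_eq ?_
  rw [Nat.add_sub_cancel, hausdorffMeasure_boxSlice, hausdorffMeasure_boxSlice, ← two_mul,
    ENNReal.ofReal_mul zero_le_two, volumeReal_box fun i => (hl i).le,
    Fin.prod_univ_succAbove _ i, mul_div_cancel_left₀ _ (hl i).ne',
    ENNReal.ofReal_prod_of_nonneg fun j _ => (hl _).le, ENNReal.ofReal_ofNat]

theorem perimeter_box_ne_top {l : Fin (n + 1) → ℝ} (hl : ∀ i, 0 < l i) :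
    perimeter (box l) ≠ ⊤ :=
  ne_top_of_le_ne_top ENNReal.ofReal_ne_top (perimeter_box_le hl)

theorem mul_perimeter_div_volume_box_le {l : Fin (n + 1) → ℝ} {R : ℝ} (hR : 0 ≤ R)
    (hl : ∀ i, 0 < l i) :
    R * (perimeter (box l)).toReal / volume.real (box l) ≤ ∑ i, 2 * R / l i := by
  have hV := volumeReal_box_pos hl
  have hP : (perimeter (box l)).toReal ≤ ∑ i, 2 * (volume.real (box l) / l i) :=
    ENNReal.toReal_le_of_le_ofReal (Finset.sum_nonneg fun i _ =>
      mul_nonneg zero_le_two (div_nonneg hV.le (hl i).le)) (perimeter_box_le hl)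
  rw [div_le_iff₀ hV]
  refine (mul_le_mul_of_nonneg_left hP hR).trans_eq ?_
  rw [Finset.mul_sum, Finset.sum_mul]
  exact Finset.sum_congr rfl fun i _ => by ring

end Perimeter

section Orthotopes

variable {κ R p : ℝ} {l : Fin D → ℝ}

theorem IsSides.two_mul_le (h : IsSides κ R l) (hκ : 2 ≤ κ) (i : Fin D) : 2 * R ≤ l i := by
  by_cases hi : i.val = 0
  · exact (h.2.1 i hi).ge
  · exact (mul_le_mul_of_nonneg_right hκ h.1.le).trans (h.2.2 i hi)

theorem IsSides.apply_zero [NeZero D] (h : IsSides κ R l) : l 0 = 2 * R :=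
  h.2.1 0 rfl

theorem IsSides.pos (h : IsSides κ R l) (hκ : 2 ≤ κ) (i : Fin D) : 0 < l i :=
  (mul_pos two_pos h.1).trans_le (h.two_mul_le hκ i)

theorem IsSides.sum_div_le [NeZero D] (h : IsSides κ R l) (hκ : 0 < κ) :
    ∑ i, 2 * R / l i ≤ 1 + 2 * ((D : ℝ) - 1) / κ := by
  have hR := h.1
  have hterm : ∀ i ∈ Finset.univ.erase (0 : Fin D), 2 * R / l i ≤ 2 / κ := fun i hi => by
    have hi0 : i.val ≠ 0 := fun hi0 => (Finset.mem_erase.1 hi).1 (Fin.ext hi0)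
    calc 2 * R / l i ≤ 2 * R / (κ * R) := by gcongr; exact h.2.2 i hi0
      _ = 2 / κ := mul_div_mul_right _ _ hR.ne'
  have hsum := Finset.sum_le_card_nsmul _ _ _ hterm
  rw [Finset.card_erase_of_mem (Finset.mem_univ _), Finset.card_univ, Fintype.card_fin,
    nsmul_eq_mul, Nat.cast_pred (Nat.pos_of_neZero D)] at hsum
  rw [← Finset.add_sum_erase _ _ (Finset.mem_univ (0 : Fin D)), h.apply_zero,
    div_self (by positivity), mul_div_right_comm, mul_comm (2 / κ)]
  exact add_le_add_right hsum 1

theorem isSides_ite (hR : 0 < R) :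
    IsSides κ R fun i : Fin D => if i.val = 0 then 2 * R else κ * R :=
  ⟨hR, fun i hi => by simp [hi], fun i hi => by simp [hi]⟩

theorem div_le_gammaFamily {F : Set (Set (E D))} {a b : ℝ} (ha : 0 < a) (hF : F.Nonempty)
    (h : ∀ Ω ∈ F, Q p Ω ∈ Set.Icc a b) : a / b ≤ gammaFamily F p := by
  have hne : (Q p '' F).Nonempty := hF.image _
  have hmem : ∀ y ∈ Q p '' F, y ∈ Set.Icc a b := Set.forall_mem_image.2 h
  obtain ⟨y, hy⟩ := hne
  have hinf : a ≤ sInf (Q p '' F) := le_csInf ⟨y, hy⟩ fun z hz => (hmem z hz).1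
  have hsup : sSup (Q p '' F) ≤ b := csSup_le ⟨y, hy⟩ fun z hz => (hmem z hz).2
  have hpos : 0 < sSup (Q p '' F) :=
    (ha.trans_le (hmem y hy).1).trans_le (le_csSup ⟨b, fun z hz => (hmem z hz).2⟩ hy)
  exact div_le_div₀ (ha.le.trans hinf) hinf hpos hsup

theorem le_gammaFamily_orthotopes [NeZero D] (hp : 1 < p) (hκ : 2 ≤ κ) :
    κ / (κ + 2 * ((D : ℝ) - 1)) ≤ gammaFamily (orthotopes D κ) p := by
  have hκ0 : 0 < κ := by linarith
  have hquot : κ / (κ + 2 * ((D : ℝ) - 1)) = 1 / (1 + 2 * ((D : ℝ) - 1) / κ) := by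
    rw [one_add_div hκ0.ne', one_div_div]
  rw [hquot]
  refine div_le_gammaFamily one_pos ⟨_, 1, _, isSides_ite one_pos, rfl⟩ ?_
  rintro _ ⟨R, l, h, rfl⟩
  have hQ := Q_box_mem_Icc (Real.HolderConjugate.conjExponent hp) h.1 (h.two_mul_le hκ) h.apply_zero
  exact ⟨hQ.1, hQ.2.trans (h.sum_div_le hκ0)⟩

end Orthotopes

end Torsion

end

theorem mainTheorem9 (D : ℕ) (hD : 2 ≤ D) (p : ℝ) (hp : 1 < p) (κ : ℝ) (hκ : 2 ≤ κ) :
    (∀ (R : ℝ) (l : Fin D → ℝ), Torsion.IsSides κ R l →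
      Torsion.inradius (Torsion.box l) = R ∧
      Torsion.perimeter (Torsion.box l) ≠ ⊤ ∧
      R * (Torsion.perimeter (Torsion.box l)).toReal / volume.real (Torsion.box l)
        ≤ 1 + 2 * ((D : ℝ) - 1) / κ) ∧
    κ / (κ + 2 * ((D : ℝ) - 1)) ≤ Torsion.gammaFamily (Torsion.orthotopes D κ) p := by
  obtain ⟨n, rfl⟩ : ∃ n, D = n + 1 := Nat.exists_eq_add_of_le' (one_le_two.trans hD)
  refine ⟨fun R l h => ⟨?_, ?_, ?_⟩, Torsion.le_gammaFamily_orthotopes hp hκ⟩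
  · exact Torsion.inradius_box h.1 (h.two_mul_le hκ) h.apply_zero
  · exact Torsion.perimeter_box_ne_top (h.pos hκ)
  · exact (Torsion.mul_perimeter_div_volume_box_le h.1.le (h.pos hκ)).trans
      (h.sum_div_le (two_pos.trans_le hκ))
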